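/- **Theorem (Correctness of FindFDSet).** Let $\mathcal G$ be a causal diagram, that is, a graph on a finite set $V$ of $n$ variables with directed edges $a\to b$, which form no directed cycle, and bidirected edges $a\leftrightarrow b$ ($a\ne b$); let $m$ be its total number of edges. Let $X,Y\subseteq V$ be disjoint and $I\subseteq R\subseteq V\setminus Y$. Then $\mathrm{FindFDSet}(\mathcal G,X,Y,I,R)$ terminates. If some set $Z$ with $I\subseteq Z\subseteq R$ satisfies the front-door criterion relative to $(X,Y)$, it returns such a set; otherwise, and only then, it returns $\perp$. If $n\ge 1$, it takes at most $C\,n^3(n+m)$ elementary steps (memory accesses and comparisons of node names), where $C$ is an absolute constant. *Terminology.* $\mathcal G_{\underline S}$ is $\mathcal G$ without the directed edges that leave $S$, $\mathcal G_{\overline S}$ is $\mathcal G$ without the edges (of both kinds) with an arrowhead at a node of $S$, and $\mathcal G_W$ is the subgraph induced by $W$. Every node is an ancestor and a descendant of itself. A path has distinct nodes. It is blocked by a set $C$ if it contains a collider with no descendant in $C$, or a non-collider that lies in $C$. $C$ is a separator of $A$ and $B$ if it blocks all paths from $A$ to $B$; a common node of $A$ and $B$ counts as a path of length $0$. A set $Z$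 satisfies the *front-door criterion* relative to $(X,Y)$ if (1) every directed path from $X$ to $Y$ contains a node of $Z$; (2) no back-door path from $X$ to $Z$ is unblocked, i.e. $\emptyset$ is a separator of $X$ and $Z$ in $\mathcal G_{\underline X}$; (3) all back-door paths from $Z$ to $Y$ are blocked by $X$, i.e. $X$ is a separator of $Z$ and $Y$ in $\mathcal G_{\underline Z}$. (In particular $Z$ is disjoint from $X\cup Y$.) *Subroutines.* The moral graph of a causal diagram is obtained by replacing each edge $a\leftrightarrow b$ by a latent node $L_{ab}$ with edges $L_{ab}\to a$, $L_{ab}\to b$, then joining every two parents of a common child and forgetting directions. $\mathrm{TestSep}(\mathcal H,A,B,C)$ tests whether $C$ is a separator of $A$ and $B$ in $\mathcal H$: it forms the moral graph of the subgraph of $\mathcal H$ induced by the ancestors of $A\cup B\cup C$, deletes $C$, and answers True if and only if a graph search from $A\setminus C$ does not reach $B$. $\mathrm{GetNeighbors}(u,\mathcal M)$ is the set of the non-latent nodes $w\neq u$ joined to $u$ in $\mathcal M$ by a path with only latent interior nodes. $\mathrm{GetDep}(\mathcal G,X,Y,T,R')$ works as follows. Let $\mathcal G'=\mathcal G_{W}$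 with $W$ the set of ancestors of $T\cup X\cup Y$, let $\mathcal M$ be the moral graph of $\mathcal G'_{\underline T}$ with $X$ deleted, set $Z'=\emptyset$, put $T$ into a queue and mark it as visited. While the queue is non-empty: remove its first element $u$; if $u\in Y$, return $\perp$; let $NR$ be the set of unvisited elements of $\mathrm{GetNeighbors}(u,\mathcal M)\cap R'$; replace $\mathcal M$ by the moral graph of $\mathcal G'_{\underline{T\cup Z'\cup NR}}$ with $X$ deleted; let $N'$ be the set of unvisited elements of $\mathrm{GetNeighbors}(u,\mathcal M)$ and $NR'$ the set of $w\in NR$ with an arrowhead of a directed or bidirected edge of $\mathcal G$ at $w$; replace $Z'$ by $Z'\cup NR$, append $N'\cup NR'$ to the queue and mark it as visited. When the queue is empty, return $Z'$. *FindFDSet.* Step 1: let $R'$ be the set of $v\in R$ for which $\mathrm{TestSep}(\mathcal G_{\underline X},X,\{v\},\emptyset)$ is True; if the test fails for some $v\in I$, return $\perp$. Step 2: let $R''$ be the set of $v\in R'$ with $\mathrm{GetDep}(\mathcal G,X,Y,\{v\},R')\neq\perp$; if the answer is $\perp$ for some $v\in I$, return $\perp$. Step 3: let $D$ be the set of descendants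 of $X$ in $\mathcal G_{\overline X}$, $A$ the set of ancestors of $Y$ in $\mathcal G_{\underline X}$, $W=X\cup Y\cup((D\setminus X)\cap A)$, and $\mathcal G'$ the graph obtained from $\mathcal G_W$ by removing all edges into $X$, all edges out of $Y$ and all bidirected edges; if $\mathrm{TestSep}(\mathcal G',X,Y,R'')$ is True, return $R''$, otherwise return $\perp$. -/

import Mathlib

namespace FrontDoor

/-! ### Causal diagrams -/

/-- A causal diagram (acyclic directed mixed graph) on the variables `0, …, n - 1`, given by the
adjacency matrices of its directed edges `a → b` and of its bidirected edges `a ↔ b`. -/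
structure ADMG (n : ℕ) where
  dir : Fin n → Fin n → Bool
  bi : Fin n → Fin n → Bool
  bi_symm : ∀ a b, bi a b = bi b a
  bi_irrefl : ∀ a, bi a a = false
  acyclic : ∀ a, ¬ Relation.TransGen (fun a b => dir a b = true) a a

variable {n : ℕ}

/-- The number of edges, directed and bidirected; each bidirected edge is counted once. -/
def ADMG.numEdges (G : ADMG n) : ℕ :=
  (Finset.univ.filter fun e : Fin n × Fin n => G.dir e.1 e.2 = true).card +
  (Finset.univ.filter fun e : Fin n × Fin n => e.1 < e.2 ∧ G.bi e.1 e.2 = true).card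

/-- Keep the directed edges `a → b` with `p a b` and the bidirected edges `a ↔ b` with both
`q a b` and `q b a`. -/
def ADMG.filterEdges (G : ADMG n) (p q : Fin n → Fin n → Bool) : ADMG n where
  dir a b := G.dir a b && p a b
  bi a b := G.bi a b && (q a b && q b a)
  bi_symm a b := by rw [G.bi_symm a b, Bool.and_comm (q a b)]
  bi_irrefl a := by simp [G.bi_irrefl a]
  acyclic a h := G.acyclic a (Relation.TransGen.mono (fun x y hxy => by
    have hxy' : (G.dir x y && p x y) = true := hxy
    rw [Bool.and_eq_true] at hxy'
    exact hxy'.1) a a h)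

/-- The graph `G` with underlined `S`: all edges `a → b` with `a ∈ S` are removed. -/
def ADMG.removeOut (G : ADMG n) (S : Finset (Fin n)) : ADMG n :=
  G.filterEdges (fun a _ => decide (a ∉ S)) (fun _ _ => true)

/-- The graph `G` with overlined `S`: all edges with an arrowhead at a node of `S` are removed. -/
def ADMG.removeIn (G : ADMG n) (S : Finset (Fin n)) : ADMG n :=
  G.filterEdges (fun _ b => decide (b ∉ S)) (fun a _ => decide (a ∉ S))

/-- The subgraph induced by `W`. The nodes outside `W` stay as isolated nodes, so that the
ambient set of variables does not change. -/
def ADMG.induce (G : ADMG n) (W : Finset (Fin n)) : ADMG n :=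
  G.filterEdges (fun a b => decide (a ∈ W) && decide (b ∈ W)) (fun a _ => decide (a ∈ W))

/-- The graph `G` without its bidirected edges. -/
def ADMG.dropBi (G : ADMG n) : ADMG n :=
  G.filterEdges (fun _ _ => true) (fun _ _ => false)

/-! ### Paths, d-separation and the front-door criterion -/

/-- The ways in which a path can traverse an edge. -/
inductive EdgeKind
  | fwd
  | bwd
  | both

/-- `G` has the edge `a → b`, `a ← b` or `a ↔ b`, respectively. -/
def ADMG.HasEdge (G : ADMG n) : EdgeKind → Fin n → Fin n → Prop
  | .fwd, a, b => G.dir a b = true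
  | .bwd, a, b => G.dir b a = true
  | .both, a, b => G.bi a b = true

/-- The edge has an arrowhead at its second endpoint. -/
def EdgeKind.HeadRight : EdgeKind → Prop
  | .fwd => True
  | .bwd => False
  | .both => True

/-- The edge has an arrowhead at its first endpoint. -/
def EdgeKind.HeadLeft : EdgeKind → Prop
  | .fwd => False
  | .bwd => True
  | .both => True

/-- `p 0, p 1, …, p len` are the successive nodes, without repetition, and `e 0, …, e (len - 1)`
the successive edges of a path in `G`. Values of `p` and `e` at larger indices are irrelevant. -/
structure ADMG.IsPath (G : ADMG n) (len : ℕ) (p : ℕ → Fin n) (e : ℕ → EdgeKind) : Prop where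
  edge : ∀ i, i < len → G.HasEdge (e i) (p i) (p (i + 1))
  inj : ∀ i j, i ≤ len → j ≤ len → p i = p j → i = j

/-- The node with index `i` is a collider on a path with the edges `e 0, …, e (len - 1)`. -/
def IsCollider (len : ℕ) (e : ℕ → EdgeKind) (i : ℕ) : Prop :=
  0 < i ∧ i < len ∧ (e (i - 1)).HeadRight ∧ (e i).HeadLeft

/-- `d` is a descendant of `a`; every node is a descendant of itself. -/
def ADMG.IsDescendant (G : ADMG n) (a d : Fin n) : Prop :=
  Relation.ReflTransGen (fun x y => G.dir x y = true) a d

/-- A path is blocked by `Z` if it has a collider without descendants in `Z` (itself included), or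
a node in `Z` that is not a collider. -/
def ADMG.Blocked (G : ADMG n) (Z : Finset (Fin n)) (len : ℕ) (p : ℕ → Fin n) (e : ℕ → EdgeKind) :
    Prop :=
  ∃ i, i ≤ len ∧
    ((IsCollider len e i ∧ ∀ d ∈ Z, ¬ G.IsDescendant (p i) d) ∨
     (¬ IsCollider len e i ∧ p i ∈ Z))

/-- `Z` is a separator of `A` and `B`: it blocks every path from a node of `A` to a node of `B`.
A common node of `A` and `B` is a path of length `0`, blocked only if this node lies in `Z`. -/
def ADMG.IsSeparator (G : ADMG n) (A B Z : Finset (Fin n)) : Prop :=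
  ∀ len p e, G.IsPath len p e → p 0 ∈ A → p len ∈ B → G.Blocked Z len p e

/-- The front-door criterion relative to `(X, Y)`. The back-door paths from a set `A` are the
paths that start in `A` in the graph with the edges out of `A` removed. For disjoint `X` and `Y`,
the paths of length `0` in the last two conditions say that `Z` is disjoint from `X` and `Y`. -/
structure FrontDoorCriterion (G : ADMG n) (X Y Z : Finset (Fin n)) : Prop where
  /-- `Z` intercepts all causal (directed) paths from `X` to `Y`. -/
  intercepts : ∀ len p e, G.IsPath len p e → (∀ i, i < len → e i = EdgeKind.fwd) →
    p 0 ∈ X → p len ∈ Y → ∃ i, i ≤ len ∧ p i ∈ Z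
  /-- There is no unblocked back-door path from `X` to `Z`. -/
  no_backdoor : (G.removeOut X).IsSeparator X Z ∅
  /-- All back-door paths from `Z` to `Y` are blocked by `X`. -/
  backdoor_blocked : (G.removeOut Z).IsSeparator Z Y X

/-! ### Step-counted computations

A value of type `Timed α` is a computation that counts its elementary steps (reading or writing
one memory cell, comparing two node names, moving to the next element of a list) up to a constant
factor, and that may diverge (`none`). Sets of nodes are stored as bit tables, graphs as adjacency
matrices or as tables of adjacency lists. A step charged below stands for a bounded number of
elementary steps. -/

abbrev Timed := StateT ℕ Option

def charge (k : ℕ) : Timed Unit := modify (· + k)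

/-- Write a bit table of length `n`; each bit is a fixed Boolean combination of stored bits. -/
def storeSet (S : Finset (Fin n)) : Timed (Finset (Fin n)) := do
  charge n
  pure S

/-- Write two `n × n` bit matrices; each bit is a fixed Boolean combination of stored bits. -/
def storeGraph (G : ADMG n) : Timed (ADMG n) := do
  charge (2 * n * n)
  pure G

/-- The elements of a list that pass a test that takes a bounded number of steps. -/
def scan {α : Type} (l : List α) (test : α → Bool) : Timed (List α) := do
  charge l.length
  pure (l.filter test)

/-- List the elements of a set of nodes. -/
def listSet (S : Finset (Fin n)) : Timed (List (Fin n)) :=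
  scan (List.finRange n) fun v => decide (v ∈ S)

/-- A loop over a list: one step per element, besides the steps of the loop body. -/
def forEach {α σ : Type} : List α → σ → (σ → α → Timed σ) → Timed σ
  | [], s, _ => pure s
  | a :: l, s, body => do
    charge 1
    let s' ← body s a
    forEach l s' body

/-- At most `k` rounds of a while loop. A round ends with a new loop state (`Sum.inl`) or with the
result of the loop (`Sum.inr`); a loop that is not over after `k` rounds yields `none`. -/
def loopFor {σ β : Type} (body : σ → Timed (σ ⊕ β)) : ℕ → σ → Timed β
  | 0, _ => fun _ => none
  | k + 1, s => do
    let r ← body s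
    match r with
    | Sum.inl s' => loopFor body k s'
    | Sum.inr b => pure b

open Classical in
/-- A while loop: the result after sufficiently many rounds, and `none` if there is none. -/
noncomputable def loop {σ β : Type} (body : σ → Timed (σ ⊕ β)) (s : σ) : Timed β := fun c =>
  if h : ∃ k, (loopFor body k s c).isSome = true then loopFor body (Nat.find h) s c else none

/-- One round of a graph search. The state consists of the list of the nodes that are still to be
expanded and of the set of the nodes found so far. -/
def searchRound {α : Type} [DecidableEq α] (nbrs : α → Timed (List α)) :
    List α × Finset α → Timed ((List α × Finset α) ⊕ Finset α)
  | ([], seen) => pure (Sum.inr seen)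
  | (u :: rest, seen) => do
    charge 1
    let N ← nbrs u
    let st ← forEach N (rest, seen) fun st w =>
      if w ∈ st.2 then pure st else pure (w :: st.1, insert w st.2)
    pure (Sum.inl st)

/-- All nodes that can be reached from `start`; initializing the table of the nodes found takes
one step per node. -/
noncomputable def reach {α : Type} [Fintype α] [DecidableEq α] (nbrs : α → Timed (List α))
    (start : List α) : Timed (Finset α) := do
  charge (Fintype.card α + start.length)
  loop (searchRound nbrs) (start, start.toFinset)

/-- The ancestors of the nodes of `S`, these nodes included. -/
noncomputable def ancestors (G : ADMG n) (S : Finset (Fin n)) : Timed (Finset (Fin n)) := do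
  let start ← listSet S
  reach (fun u => scan (List.finRange n) fun a => G.dir a u) start

/-- The descendants of the nodes of `S`, these nodes included. -/
noncomputable def descendants (G : ADMG n) (S : Finset (Fin n)) : Timed (Finset (Fin n)) := do
  let start ← listSet S
  reach (fun u => scan (List.finRange n) fun b => G.dir u b) start

/-! ### Moral graphs -/

/-- Observed nodes `Sum.inl a`, and a latent node `Sum.inr s(a, b)` for each possible bidirected
edge `a ↔ b`. -/
abbrev Node (n : ℕ) := Fin n ⊕ Sym2 (Fin n)

/-- Replace each bidirected edge `a ↔ b` by a latent node with edges into `a` and `b`; the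
resulting directed graph is given by its table of parent lists (latent nodes have no parents). -/
def addLatents (G : ADMG n) : Timed (Fin n → List (Node n)) := do
  charge n
  forEach (List.finRange n) (fun _ => []) fun pa c => do
    let P ← scan (List.finRange n) fun a => G.dir a c
    let B ← scan (List.finRange n) fun b => G.bi b c
    pure (Function.update pa c (P.map Sum.inl ++ B.map fun b => Sum.inr s(b, c)))

/-- The node is an observed node of `S`. -/
def inSet (S : Finset (Fin n)) : Node n → Bool
  | Sum.inl v => decide (v ∈ S)
  | Sum.inr _ => false

/-- Put `q` on the adjacency list of `p`, unless one of the two is removed. -/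
def addArc (removed : Finset (Fin n)) (M : Node n → List (Node n)) (p q : Node n) :
    Node n → List (Node n) :=
  if inSet removed p || inSet removed q then M else Function.update M p (q :: M p)

/-- The adjacency lists of the moral graph of `G`, its bidirected edges having been replaced by
latent nodes, after removal of the nodes in `removed`: each node is joined to its parents, and the
parents of a node are joined to each other. -/
def moralize (G : ADMG n) (removed : Finset (Fin n)) : Timed (Node n → List (Node n)) := do
  let pa ← addLatents G
  charge (Fintype.card (Node n))
  forEach (List.finRange n) (fun _ => []) fun M c => do
    let M ← forEach (pa c) M fun M p =>
      pure (addArc removed (addArc removed M p (Sum.inl c)) (Sum.inl c) p)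
    forEach (pa c) M fun M p =>
      forEach (pa c) M fun M q =>
        if p = q then pure M else pure (addArc removed M p q)

/-- `TestSep`: is `C` a separator of `A` and `B` in `G`? The test looks for a path from `A` to `B`
in the moral graph of the ancestors of `A ∪ B ∪ C`, with `C` removed. -/
noncomputable def testSep (G : ADMG n) (A B C : Finset (Fin n)) : Timed Bool := do
  let S ← storeSet (A ∪ B ∪ C)
  let W ← ancestors G S
  let H ← storeGraph (G.induce W)
  let M ← moralize H C
  let S' ← storeSet (A \ C)
  let start ← listSet S'
  let seen ← reach (fun w => pure (M w)) (start.map Sum.inl)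
  let hits ← scan (List.finRange n) fun b => decide (b ∈ B) && decide (Sum.inl b ∈ seen)
  pure hits.isEmpty

/-- `GetNeighbors`: the observed nodes other than `u` that are joined to `u` in `M` by a path whose
interior nodes are all latent. -/
noncomputable def getNeighbors (u : Fin n) (M : Node n → List (Node n)) :
    Timed (Finset (Fin n)) := do
  let seen ← reach
    (fun w => match w with
      | Sum.inl v => if v = u then pure (M w) else pure []
      | Sum.inr _ => pure (M w))
    [Sum.inl u]
  storeSet (Finset.univ.filter fun v => v ≠ u ∧ Sum.inl v ∈ seen)

/-! ### The algorithm -/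

/-- The loop of `GetCand2ndFDC` over a list of variables; `GX` is the graph with the edges out of
`X` removed, and `none` is the answer `⊥`. -/
noncomputable def getCand2ndLoop (GX : ADMG n) (X I : Finset (Fin n)) :
    List (Fin n) → Finset (Fin n) → Timed (Option (Finset (Fin n)))
  | [], R' => pure (some R')
  | v :: vs, R' => do
    charge 1
    let V ← storeSet {v}
    let E ← storeSet ∅
    let sep ← testSep GX X V E
    if sep then getCand2ndLoop GX X I vs R'
    else if v ∈ I then pure none
    else getCand2ndLoop GX X I vs (R'.erase v)

/-- `GetCand2ndFDC`. -/
noncomputable def getCand2ndFDC (G : ADMG n) (X I R : Finset (Fin n)) :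
    Timed (Option (Finset (Fin n))) := do
  let GX ← storeGraph (G.removeOut X)
  let R' ← storeSet R
  let vs ← listSet R
  getCand2ndLoop GX X I vs R'

/-- The variables of `GetDep` that its while loop changes: the queue, the moral graph, the set of
the visited nodes and the set `Z'`. -/
structure DepState (n : ℕ) where
  Q : List (Fin n)
  M : Node n → List (Node n)
  visited : Finset (Fin n)
  Z' : Finset (Fin n)

/-- One round of the while loop of `GetDep`. Here `G'` is the subgraph of `G` over the ancestors of
`T ∪ X ∪ Y`, and `heads` is the set of the nodes with an incoming arrow in `G`. -/
noncomputable def getDepRound (G' : ADMG n) (X Y T R' heads : Finset (Fin n)) (s : DepState n) :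
    Timed (DepState n ⊕ Option (Finset (Fin n))) :=
  match s.Q with
  | [] => pure (Sum.inr (some s.Z'))
  | u :: rest => do
    charge 1
    if u ∈ Y then pure (Sum.inr none)
    else do
      let A ← getNeighbors u s.M
      let NR ← storeSet ((A ∩ R') \ s.visited)
      let G'' ← storeGraph (G'.removeOut (T ∪ s.Z' ∪ NR))
      let M ← moralize G'' X
      let A' ← getNeighbors u M
      let N' ← storeSet (A' \ s.visited)
      let NR' ← storeSet (NR ∩ heads)
      let N ← storeSet (N' ∪ NR')
      let Z' ← storeSet (s.Z' ∪ NR)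
      let L ← listSet N
      let visited ← storeSet (s.visited ∪ N)
      pure (Sum.inl ⟨rest ++ L, M, visited, Z'⟩)

/-- `GetDep`. -/
noncomputable def getDep (G : ADMG n) (X Y T R' : Finset (Fin n)) :
    Timed (Option (Finset (Fin n))) := do
  let S ← storeSet (T ∪ X ∪ Y)
  let W ← ancestors G S
  let G' ← storeGraph (G.induce W)
  let G'' ← storeGraph (G'.removeOut T)
  let M ← moralize G'' X
  -- An arrow into `w` is an edge with an arrowhead at `w`, directed or bidirected.
  charge (2 * n * n)
  let heads ← storeSet (Finset.univ.filter fun w => ∃ a, G.dir a w = true ∨ G.bi a w = true)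
  let Q ← listSet T
  let visited ← storeSet T
  let Z' ← storeSet ∅
  loop (getDepRound G' X Y T R' heads) ⟨Q, M, visited, Z'⟩

/-- The loop of `GetCand3rdFDC` over a list of variables. -/
noncomputable def getCand3rdLoop (G : ADMG n) (X Y I R' : Finset (Fin n)) :
    List (Fin n) → Finset (Fin n) → Timed (Option (Finset (Fin n)))
  | [], R'' => pure (some R'')
  | v :: vs, R'' => do
    charge 1
    let V ← storeSet {v}
    let dep ← getDep G X Y V R'
    if dep.isSome then getCand3rdLoop G X Y I R' vs R''
    else if v ∈ I then pure none
    else getCand3rdLoop G X Y I R' vs (R''.erase v)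

/-- `GetCand3rdFDC`. -/
noncomputable def getCand3rdFDC (G : ADMG n) (X Y I R' : Finset (Fin n)) :
    Timed (Option (Finset (Fin n))) := do
  let R'' ← storeSet R'
  let vs ← listSet R'
  getCand3rdLoop G X Y I R' vs R''

/-- `GetCausalPathGraph`: the subgraph over `X`, `Y` and the set `PCP` of the variables on proper
causal paths from `X` to `Y`, without the edges into `X`, the edges out of `Y` and the bidirected
edges. -/
noncomputable def getCausalPathGraph (G : ADMG n) (X Y : Finset (Fin n)) : Timed (ADMG n) := do
  let G₁ ← storeGraph (G.removeIn X)
  let D ← descendants G₁ X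
  let G₂ ← storeGraph (G.removeOut X)
  let A ← ancestors G₂ Y
  let PCP ← storeSet ((D \ X) ∩ A)
  let W ← storeSet (X ∪ Y ∪ PCP)
  let G'' ← storeGraph (G.induce W)
  storeGraph (((G''.removeIn X).removeOut Y).dropBi)

/-- `FindFDSet`; the answer `⊥` is `none`. -/
noncomputable def findFDSet (G : ADMG n) (X Y I R : Finset (Fin n)) :
    Timed (Option (Finset (Fin n))) := do
  let r₁ ← getCand2ndFDC G X I R
  match r₁ with
  | none => pure none
  | some R' => do
    let r₂ ← getCand3rdFDC G X Y I R'
    match r₂ with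
    | none => pure none
    | some R'' => do
      let G' ← getCausalPathGraph G X Y
      let sep ← testSep G' X Y R''
      if sep then pure (some R'') else pure none

end FrontDoor

namespace FrontDoor

/-! Why the algorithm is correct. The second front-door condition concerns each node of Z separately
(`isSeparator_iff_singleton`), so Step 1 yields the largest set R' ⊆ R that satisfies it. The third
condition passes to unions (`backdoorSep_of_cover`), so the union R'' of all subsets of R' that
satisfy it satisfies it too. Every front-door set between I and R therefore lies in R''. As the
first condition can only become easier when Z grows, a solution exists if and only if I ⊆ R'' and
R'' meets all directed paths from X to Y, and then R'' is one.

Three facts link this to the code. `sat_testSep` is the theorem that d-separation is separation in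
the moral graph of the ancestors; it is proved with active walks (`Conn`), which `Conn.exists_path`
shortens to paths. `sat_getDep` shows that `getDep` succeeds exactly if some admissible Z contains
T: whatever it visits is reachable from every admissible Z in the moral graph belonging to Z, and if
Y is never visited, the collected set is itself admissible. `intercepts_of_isSeparator` and
`isSeparator_of_intercepts` show that the last test decides the first condition; the latter needs
the third condition for R'', since an active path that is not directed would contain a fork that
opens a back-door path (`false_of_fork`).

For the running time, building or searching one moral graph costs O(n(n + m)) up to an additive
constant. A run of `getDep` has at most n rounds and there are at most n runs, hence n³(n + m).
`Sat` combines result and time bound, and a potential pays for each while loop (`sat_loop`). -/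

/-! ### Specifications of step-counted computations -/

section Timed

variable {α β σ : Type}

/-- The computation halts after at most `k` steps with a result that satisfies `P`. -/
def Sat (x : Timed α) (k : ℕ) (P : α → Prop) : Prop :=
  ∃ a t, t ≤ k ∧ P a ∧ ∀ c, x c = some (a, c + t)

theorem Sat.mono {x : Timed α} {k l : ℕ} {P Q : α → Prop} (h : Sat x k P) (hkl : k ≤ l)
    (hPQ : ∀ a, P a → Q a) : Sat x l Q := by
  obtain ⟨a, t, ht, ha, hx⟩ := h
  exact ⟨a, t, ht.trans hkl, hPQ a ha, hx⟩

theorem Sat.pure {a : α} {P : α → Prop} (h : P a) (k : ℕ) : Sat (pure a : Timed α) k P :=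
  ⟨a, 0, Nat.zero_le _, h, fun _ => rfl⟩

theorem Sat.bind {x : Timed α} {f : α → Timed β} {k l : ℕ} {P : α → Prop} {Q : β → Prop}
    (hx : Sat x k P) (hf : ∀ a, P a → Sat (f a) l Q) : Sat (x >>= f) (k + l) Q := by
  obtain ⟨a, t, ht, ha, hx⟩ := hx
  obtain ⟨b, u, hu, hb, hfa⟩ := hf a ha
  refine ⟨b, t + u, Nat.add_le_add ht hu, hb, fun c => ?_⟩
  change (x c).bind (fun r => f r.1 r.2) = _
  rw [hx c]
  change f a (c + t) = _
  rw [hfa, Nat.add_assoc]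

theorem sat_charge (k : ℕ) : Sat (charge k) k fun _ => True :=
  ⟨(), k, le_rfl, trivial, fun _ => rfl⟩

theorem Sat.charge_bind {f : Unit → Timed β} {k l : ℕ} {Q : β → Prop} (hf : Sat (f ()) l Q) :
    Sat (charge k >>= f) (k + l) Q :=
  Sat.bind (sat_charge k) fun _ _ => hf

theorem Sat.ite {p : Prop} [Decidable p] {x y : Timed α} {k : ℕ} {P : α → Prop}
    (hx : p → Sat x k P) (hy : ¬ p → Sat y k P) : Sat (if p then x else y) k P := by
  by_cases hp : p
  · rw [if_pos hp]; exact hx hp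
  · rw [if_neg hp]; exact hy hp

theorem sat_storeSet {n : ℕ} (S : Finset (Fin n)) : Sat (storeSet S) n fun T => T = S :=
  Sat.charge_bind (l := 0) (Sat.pure (P := fun T => T = S) rfl 0)

theorem sat_storeGraph {n : ℕ} (G : ADMG n) : Sat (storeGraph G) (2 * n * n) fun H => H = G :=
  Sat.charge_bind (l := 0) (Sat.pure (P := fun H => H = G) rfl 0)

theorem sat_scan (l : List α) (test : α → Bool) :
    Sat (scan l test) l.length fun l' => l' = l.filter test :=
  Sat.charge_bind (l := 0) (Sat.pure (P := fun l' => l' = l.filter test) rfl 0)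

theorem sat_listSet {n : ℕ} (S : Finset (Fin n)) :
    Sat (listSet S) n fun l => l.Nodup ∧ l.toFinset = S := by
  refine (sat_scan _ _).mono (by simp) ?_
  rintro _ rfl
  refine ⟨(List.nodup_finRange n).filter _, ?_⟩
  ext v
  simp

/-- The invariant of a loop over a list takes the list of the remaining elements. -/
theorem sat_forEach {body : σ → α → Timed σ} (Inv : List α → σ → Prop) (k : α → ℕ) (l : List α)
    (step : ∀ a l' s, a ∈ l → Inv (a :: l') s → Sat (body s a) (k a) (Inv l')) (s : σ)
    (h : Inv l s) : Sat (forEach l s body) (l.map fun a => 1 + k a).sum (Inv []) := by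
  induction l generalizing s with
  | nil => exact Sat.pure h _
  | cons a l ih =>
    rw [List.map_cons, List.sum_cons, Nat.add_assoc]
    refine Sat.charge_bind (Sat.bind (step a l s List.mem_cons_self h) fun s' hs' => ?_)
    exact ih (fun b l' t hb => step b l' t (List.mem_cons_of_mem a hb)) s' hs'

theorem loopFor_succ {body : σ → Timed (σ ⊕ β)} {k : ℕ} {s : σ} {c : ℕ} {r : β × ℕ}
    (h : loopFor body k s c = some r) : loopFor body (k + 1) s c = some r := by
  induction k generalizing s c with
  | zero => exact absurd h (by simp [loopFor])
  | succ k ih =>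
    change (body s c).bind _ = _ at h
    change (body s c).bind _ = _
    cases hb : body s c with
    | none => rw [hb] at h; exact absurd h (by simp)
    | some v =>
      obtain ⟨v, d⟩ := v
      rw [hb] at h
      cases v with
      | inl s' => exact ih (s := s') (c := d) h
      | inr b => exact h

theorem loopFor_mono {body : σ → Timed (σ ⊕ β)} {k l : ℕ} {s : σ} {c : ℕ} {r : β × ℕ}
    (hkl : k ≤ l) (h : loopFor body k s c = some r) : loopFor body l s c = some r := by
  induction hkl with
  | refl => exact h
  | step _ ih => exact loopFor_succ ih

/-- Extra rounds do not alter a result, so the least sufficient number of rounds chosen by `loop`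
may be replaced by any sufficient one. -/
theorem loop_eq {body : σ → Timed (σ ⊕ β)} {k : ℕ} {s : σ} {c : ℕ} {r : β × ℕ}
    (h : loopFor body k s c = some r) : loop body s c = some r := by
  classical
  have hex : ∃ k, (loopFor body k s c).isSome = true := ⟨k, by rw [h]; rfl⟩
  rw [loop, dif_pos hex]
  obtain ⟨r', hr'⟩ := Option.isSome_iff_exists.1 (Nat.find_spec hex)
  have := loopFor_mono (Nat.find_min' hex (by rw [h]; rfl)) hr'
  rw [hr', ← this, h]

/-- A while loop with an invariant and a potential that pays for the rounds. -/
theorem sat_loop {body : σ → Timed (σ ⊕ β)} {Q : β → Prop} (Inv : σ → Prop) (φ : σ → ℕ)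
    (step : ∀ s, Inv s → ∃ k, Sat (body s) k
      (Sum.elim (fun s' => Inv s' ∧ φ s' < φ s ∧ k + φ s' ≤ φ s) (fun b => k ≤ φ s ∧ Q b)))
    (s : σ) (hs : Inv s) : Sat (loop body s) (φ s) Q := by
  -- The potential drops strictly in each round, so `φ s + 1` rounds are enough. The strict drop is
  -- a separate demand because a round may cost 0.
  suffices H : ∀ N s, φ s < N → Inv s → Sat (loopFor body N s) (φ s) Q by
    obtain ⟨a, t, ht, ha, hx⟩ := H (φ s + 1) s (Nat.lt_succ_self _) hs
    exact ⟨a, t, ht, ha, fun c => loop_eq (hx c)⟩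
  intro N
  induction N with
  | zero => intro s h; exact absurd h (Nat.not_lt_zero _)
  | succ N ih =>
    intro s hN hs
    obtain ⟨k, r, t, ht, hr, hx⟩ := step s hs
    have hb : Sat (body s) t fun r' => r' = r := ⟨r, t, le_rfl, rfl, hx⟩
    cases r with
    | inl s' =>
      obtain ⟨h1, h2, h3⟩ := hr
      refine Sat.mono (Sat.bind (l := φ s') hb ?_) (show t + φ s' ≤ φ s by omega) fun _ h => h
      rintro _ rfl
      exact ih s' (by omega) h1
    | inr b =>
      obtain ⟨h1, h2⟩ := hr
      refine Sat.mono (Sat.bind (l := 0) hb ?_) (show t + 0 ≤ φ s by omega) fun _ h => h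
      rintro _ rfl
      exact Sat.pure h2 _

end Timed

open Relation

/-! ### Graph searches -/

section Reach

variable {α : Type} [Fintype α] [DecidableEq α]

/-- The potential of a graph search: the cost of all nodes that are not yet expanded. -/
def searchPotential (w : α → ℕ) (st : List α × Finset α) : ℕ :=
  (st.1.map w).sum + ∑ u ∈ Finset.univ \ st.2, w u

/-- The weight of `v` moves from the sum over unseen nodes to the sum over the stack. -/
theorem searchPotential_push (w : α → ℕ) (l : List α) (seen : Finset α) {v : α} (hv : v ∉ seen) :
    searchPotential w (v :: l, insert v seen) = searchPotential w (l, seen) := by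
  have : Finset.univ \ seen = insert v (Finset.univ \ insert v seen) := by
    ext u
    by_cases hu : u = v <;> simp [hu, hv]
  simp only [searchPotential, List.map_cons, List.sum_cons]
  rw [this, Finset.sum_insert (by simp)]
  omega

/-- Compares the state before the neighbours `N` are pushed with the state in which `l` is still to
be treated. By `stack`, a node found during the pass must be on the stack. -/
structure PushInv (w : α → ℕ) (rest : List α) (seen : Finset α) (N : List α)
    (l : List α) (st : List α × Finset α) : Prop where
  potential : searchPotential w st = searchPotential w (rest, seen)
  mem_seen : ∀ v, v ∈ seen ∨ v ∈ N ↔ v ∈ st.2 ∨ v ∈ l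
  seen_subset : ∀ v ∈ seen, v ∈ st.2
  stack : ∀ v ∈ st.2, v ∉ st.1 → v ∈ seen ∧ v ∉ rest
  subset_seen : (∀ v ∈ rest, v ∈ seen) → ∀ v ∈ st.1, v ∈ st.2

theorem sat_pushNeighbors (w : α → ℕ) (rest : List α) (seen : Finset α) (N : List α) :
    Sat (forEach N (rest, seen) fun st v =>
      if v ∈ st.2 then pure st else pure (v :: st.1, insert v st.2)) N.length
      (PushInv w rest seen N []) := by
  refine (sat_forEach (PushInv w rest seen N) (fun _ => 0) N ?_ (rest, seen)
    ⟨rfl, fun v => Iff.rfl, fun v h => h, ?_, fun h => h⟩).mono (by simp) fun _ h => h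
  · rintro v l ⟨l', S⟩ - ⟨h1, h2, h3, h4, h5⟩
    refine Sat.ite (fun hv => Sat.pure ⟨h1, ?_, h3, h4, h5⟩ _)
      fun hv => Sat.pure ⟨?_, ?_, ?_, ?_, ?_⟩ _
    · intro u
      rw [h2 u, List.mem_cons]
      constructor
      · rintro (h | rfl | h)
        exacts [Or.inl h, Or.inl hv, Or.inr h]
      · rintro (h | h)
        exacts [Or.inl h, Or.inr (Or.inr h)]
    · rw [searchPotential_push _ _ _ hv, h1]
    · intro u
      rw [h2 u, List.mem_cons, Finset.mem_insert]
      tauto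
    · exact fun u hu => Finset.mem_insert_of_mem (h3 u hu)
    · intro u hu hl
      simp only [List.mem_cons, not_or] at hl
      exact h4 u (Finset.mem_of_mem_insert_of_ne hu hl.1) hl.2
    · intro hr u hu
      rcases List.mem_cons.1 hu with rfl | hu
      · exact Finset.mem_insert_self _ _
      · exact Finset.mem_insert_of_mem (h5 hr u hu)
  · exact fun v h h' => ⟨h, h'⟩

/-- Once the stack is empty, `closed` makes the set of found nodes closed under `f`, so it contains
all that can be reached. -/
structure SearchInv (f : α → List α) (start : List α) (st : List α × Finset α) : Prop where
  stack : ∀ v ∈ st.1, v ∈ st.2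
  start_subset : ∀ v ∈ start, v ∈ st.2
  closed : ∀ u ∈ st.2, u ∉ st.1 → ∀ v ∈ f u, v ∈ st.2
  sound : ∀ v ∈ st.2, ∃ u ∈ start, ReflTransGen (fun a b => b ∈ f a) u v

theorem sat_reach {nbrs : α → Timed (List α)} {f : α → List α} {k : α → ℕ}
    (h : ∀ u, Sat (nbrs u) (k u) fun l => l = f u) {start : List α} (hs : start.Nodup) :
    Sat (reach nbrs start)
      (Fintype.card α + start.length + ∑ u, (1 + k u + (f u).length))
      fun S => ∀ v, v ∈ S ↔ ∃ u ∈ start, ReflTransGen (fun a b => b ∈ f a) u v := by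
  -- The weight of a node pays for taking it off the stack, for listing its neighbours and for the
  -- pass over them. As `start` has no repetitions, the initial potential counts each node exactly
  -- once.
  set w : α → ℕ := fun u => 1 + k u + (f u).length with hw
  have hstart : searchPotential w (start, start.toFinset) = ∑ u, w u := by
    rw [searchPotential, ← List.sum_toFinset w hs, add_comm]
    exact Finset.sum_sdiff (Finset.subset_univ _)
  rw [← hstart]
  refine Sat.charge_bind (sat_loop (SearchInv f start) (searchPotential w) ?_ _ ?_)
  · rintro ⟨l, seen⟩ ⟨h1, h2, h3, h4⟩
    cases l with
    | nil =>
      refine ⟨0, Sat.pure ⟨Nat.zero_le _, fun v => ⟨h4 v, ?_⟩⟩ 0⟩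
      rintro ⟨u, hu, huv⟩
      induction huv with
      | refl => exact h2 u hu
      | tail _ hbc ih => exact h3 _ ih (by simp) _ hbc
    | cons u rest =>
      refine ⟨1 + (k u + ((f u).length + 0)), Sat.charge_bind (Sat.bind (h u) ?_)⟩
      rintro _ rfl
      refine Sat.bind (sat_pushNeighbors w rest seen (f u)) ?_
      rintro ⟨l', seen'⟩ ⟨g1, g2, g3, g4, g5⟩
      simp only [List.not_mem_nil, or_false] at g2
      have hφ : searchPotential w (u :: rest, seen) = w u + searchPotential w (rest, seen) := by
        simp only [searchPotential, List.map_cons, List.sum_cons]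
        omega
      have hu : u ∈ seen := h1 u List.mem_cons_self
      refine Sat.pure ⟨⟨g5 fun v hv => h1 v (List.mem_cons_of_mem _ hv),
        fun v hv => g3 v (h2 v hv), ?_, ?_⟩, ?_, ?_⟩ 0
      · intro v hv hvl x hx
        obtain ⟨a, b⟩ := g4 v hv hvl
        by_cases hvu : v = u
        · subst hvu
          exact (g2 x).1 (Or.inr hx)
        · exact g3 _ (h3 v a (by simp [hvu, b]) x hx)
      · intro v hv
        rcases (g2 v).2 hv with hv | hv
        · exact h4 v hv
        · obtain ⟨a, ha, hau⟩ := h4 u hu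
          exact ⟨a, ha, hau.tail hv⟩
      · have : 1 ≤ w u := by simp only [hw]; omega
        rw [hφ, g1]; omega
      · have : w u = 1 + k u + (f u).length := rfl
        rw [hφ, g1, this]; omega
  · refine ⟨by simp, by simp, ?_, ?_⟩
    · intro u hu hu'
      exact absurd (List.mem_toFinset.1 hu) hu'
    · exact fun v hv => ⟨v, List.mem_toFinset.1 hv, ReflTransGen.refl⟩

end Reach

variable {n : ℕ}

theorem isDescendant_swap {G : ADMG n} {a d : Fin n} :
    ReflTransGen (fun x y => G.dir y x = true) d a ↔ G.IsDescendant a d :=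
  reflTransGen_swap

theorem sat_ancestors (G : ADMG n) (S : Finset (Fin n)) :
    Sat (ancestors G S) (4 * n + 2 * n * n)
      fun W => ∀ v, v ∈ W ↔ ∃ d ∈ S, G.IsDescendant v d := by
  refine Sat.mono (Sat.bind (l := 3 * n + 2 * n * n) (sat_listSet S) ?_) (by omega) fun _ h => h
  rintro l ⟨hl, rfl⟩
  have hlen : l.length ≤ n := by simpa using hl.length_le_card
  refine (sat_reach (f := fun u => (List.finRange n).filter fun a => G.dir a u)
    (k := fun _ => n) (fun u => (sat_scan _ _).mono (by simp) fun _ h => h) hl).mono ?_ ?_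
  · have : ∑ u : Fin n, (1 + n + ((List.finRange n).filter fun a => G.dir a u).length) ≤
        ∑ u : Fin n, (1 + n + n) := by
      refine Finset.sum_le_sum fun u _ => ?_
      have := List.length_filter_le (fun a => G.dir a u) (List.finRange n)
      rw [List.length_finRange] at this
      omega
    rw [Finset.sum_const, Finset.card_univ, Fintype.card_fin, smul_eq_mul] at this
    rw [Fintype.card_fin]
    nlinarith
  · intro W hW v
    rw [hW v]
    simp [← isDescendant_swap]

theorem sat_descendants (G : ADMG n) (S : Finset (Fin n)) :
    Sat (descendants G S) (4 * n + 2 * n * n)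
      fun W => ∀ v, v ∈ W ↔ ∃ a ∈ S, G.IsDescendant a v := by
  refine Sat.mono (Sat.bind (l := 3 * n + 2 * n * n) (sat_listSet S) ?_) (by omega) fun _ h => h
  rintro l ⟨hl, rfl⟩
  have hlen : l.length ≤ n := by simpa using hl.length_le_card
  refine (sat_reach (f := fun u => (List.finRange n).filter fun b => G.dir u b)
    (k := fun _ => n) (fun u => (sat_scan _ _).mono (by simp) fun _ h => h) hl).mono ?_ ?_
  · have : ∑ u : Fin n, (1 + n + ((List.finRange n).filter fun b => G.dir u b).length) ≤
        ∑ u : Fin n, (1 + n + n) := by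
      refine Finset.sum_le_sum fun u _ => ?_
      have := List.length_filter_le (fun b => G.dir u b) (List.finRange n)
      rw [List.length_finRange] at this
      omega
    rw [Finset.sum_const, Finset.card_univ, Fintype.card_fin, smul_eq_mul] at this
    rw [Fintype.card_fin]
    nlinarith
  · intro W hW v
    rw [hW v]
    simp [ADMG.IsDescendant]

/-! ### Moral graphs -/

/-- `p` is a parent of `c` after each bidirected edge has been replaced by a latent node. -/
def ADMG.ParentOf (G : ADMG n) : Node n → Fin n → Prop
  | Sum.inl a, c => G.dir a c = true
  | Sum.inr e, c => ∃ b, G.bi b c = true ∧ e = s(b, c)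

/-- Adjacency that the family of `c` contributes to the moral graph. -/
def FamilyAdj (par : Node n → Fin n → Prop) (c : Fin n) (p q : Node n) : Prop :=
  (par p c ∧ q = Sum.inl c) ∨ (p = Sum.inl c ∧ par q c) ∨ (p ≠ q ∧ par p c ∧ par q c)

/-- Adjacency in the moral graph of `G` without the nodes in `removed`. -/
def MoralAdj (G : ADMG n) (removed : Finset (Fin n)) (p q : Node n) : Prop :=
  inSet removed p = false ∧ inSet removed q = false ∧ ∃ c, FamilyAdj G.ParentOf c p q

/-- The table lists the relation `T` and has at most `L` entries. -/
def IsTable (T : Node n → Node n → Prop) (L : ℕ) (M : Node n → List (Node n)) : Prop :=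
  (∀ p q, q ∈ M p ↔ T p q) ∧ ∑ p, (M p).length ≤ L

theorem mem_addArc {removed : Finset (Fin n)} {M : Node n → List (Node n)} {p q p' q' : Node n} :
    q' ∈ addArc removed M p q p' ↔ q' ∈ M p' ∨
      (p' = p ∧ q' = q ∧ inSet removed p = false ∧ inSet removed q = false) := by
  unfold addArc
  by_cases h : (inSet removed p || inSet removed q) = true
  · rw [if_pos h]
    simp only [Bool.or_eq_true] at h
    constructor
    · exact Or.inl
    · rintro (h' | ⟨-, -, h1, h2⟩)
      · exact h'
      · simp [h1, h2] at h
  · rw [if_neg h]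
    simp only [Bool.or_eq_true, not_or, Bool.not_eq_true] at h
    by_cases hp : p' = p
    · subst hp
      simp [h.1, h.2, or_comm]
    · simp [hp]

theorem sum_length_addArc (removed : Finset (Fin n)) (M : Node n → List (Node n))
    (p q : Node n) : ∑ r, (addArc removed M p q r).length ≤ ∑ r, (M r).length + 1 := by
  unfold addArc
  split_ifs
  · omega
  · have : ∀ r, (Function.update M p (q :: M p) r).length =
        (M r).length + if r = p then 1 else 0 := by
      intro r
      by_cases hr : r = p
      · subst hr; simp
      · simp [hr]
    simp [this, Finset.sum_add_distrib]

theorem sat_addLatents (G : ADMG n) :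
    Sat (addLatents G) (2 * n + 2 * n * n) fun pa => ∀ c, pa c =
      ((List.finRange n).filter fun a => G.dir a c).map Sum.inl ++
      ((List.finRange n).filter fun b => G.bi b c).map fun b => Sum.inr s(b, c) := by
  refine Sat.mono (k := n + ((List.finRange n).map fun _ => 1 + (n + (n + 0))).sum)
    (Sat.charge_bind (sat_forEach (fun l pa => ∀ c, c ∉ l → pa c =
      ((List.finRange n).filter fun a => G.dir a c).map Sum.inl ++
      ((List.finRange n).filter fun b => G.bi b c).map fun b => Sum.inr s(b, c))
    _ _ ?_ _ fun c hc => absurd (List.mem_finRange c) hc)) ?_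
    fun pa h c => h c (List.not_mem_nil)
  · intro c l pa _ h
    refine Sat.bind ((sat_scan _ _).mono (by simp) fun _ h => h) ?_
    rintro _ rfl
    refine Sat.bind ((sat_scan _ _).mono (by simp) fun _ h => h) ?_
    rintro _ rfl
    refine Sat.pure ?_ 0
    intro d hd
    by_cases hdc : d = c
    · subst hdc; simp
    · rw [Function.update_of_ne hdc]
      exact h d (by simp [hdc, hd])
  · simp only [List.map_const', List.length_finRange, List.sum_replicate, smul_eq_mul]
    nlinarith

/-- The loop invariant looks forward: the table together with the arcs still to come is the final
relation, and its size plus the number of these arcs stays within the bound. No record of the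
treated elements is needed. The nested loops below are handled in the same way. -/
theorem sat_addChildArcs (removed : Finset (Fin n)) (l : List (Node n)) (c : Fin n)
    (M : Node n → List (Node n)) :
    Sat (forEach l M fun M p =>
        pure (addArc removed (addArc removed M p (Sum.inl c)) (Sum.inl c) p)) l.length
      (IsTable (fun p q => q ∈ M p ∨ (inSet removed p = false ∧ inSet removed q = false ∧
        ((p ∈ l ∧ q = Sum.inl c) ∨ (p = Sum.inl c ∧ q ∈ l))))
        (∑ p, (M p).length + 2 * l.length)) := by
  refine (sat_forEach
    (fun l' M' => (∀ p q, (q ∈ M' p ∨ (inSet removed p = false ∧ inSet removed q = false ∧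
        ((p ∈ l' ∧ q = Sum.inl c) ∨ (p = Sum.inl c ∧ q ∈ l')))) ↔
        (q ∈ M p ∨ (inSet removed p = false ∧ inSet removed q = false ∧
        ((p ∈ l ∧ q = Sum.inl c) ∨ (p = Sum.inl c ∧ q ∈ l))))) ∧
      ∑ p, (M' p).length + 2 * l'.length ≤ ∑ p, (M p).length + 2 * l.length)
    (fun _ => 0) l ?_ M ⟨fun _ _ => Iff.rfl, le_rfl⟩).mono (by simp) ?_
  · rintro r l' M' - ⟨h1, h2⟩
    refine Sat.pure ⟨fun p q => ?_, ?_⟩ _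
    · rw [← h1 p q, mem_addArc, mem_addArc, List.mem_cons, List.mem_cons]
      constructor
      · rintro (((h | ⟨rfl, rfl, h3, h4⟩) | ⟨rfl, rfl, h3, h4⟩) | ⟨h3, h4, h5⟩)
        · exact Or.inl h
        · exact Or.inr ⟨h3, h4, Or.inl ⟨Or.inl rfl, rfl⟩⟩
        · exact Or.inr ⟨h3, h4, Or.inr ⟨rfl, Or.inl rfl⟩⟩
        · exact Or.inr ⟨h3, h4, h5.imp (fun h => ⟨Or.inr h.1, h.2⟩) fun h => ⟨h.1, Or.inr h.2⟩⟩
      · rintro (h | ⟨h3, h4, ⟨rfl | h5, h6⟩ | ⟨h5, rfl | h6⟩⟩)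
        · exact Or.inl (Or.inl (Or.inl h))
        · subst h6; exact Or.inl (Or.inl (Or.inr ⟨rfl, rfl, h3, h4⟩))
        · exact Or.inr ⟨h3, h4, Or.inl ⟨h5, h6⟩⟩
        · subst h5; exact Or.inl (Or.inr ⟨rfl, rfl, h3, h4⟩)
        · exact Or.inr ⟨h3, h4, Or.inr ⟨h5, h6⟩⟩
    · have h3 := sum_length_addArc removed M' r (Sum.inl c)
      have h4 := sum_length_addArc removed (addArc removed M' r (Sum.inl c)) (Sum.inl c) r
      rw [List.length_cons] at h2
      omega
  · rintro M' ⟨h1, h2⟩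
    exact ⟨fun p q => by simpa using h1 p q, by simpa using h2⟩

theorem sat_addCoparentArcs (removed : Finset (Fin n)) (l : List (Node n))
    (M : Node n → List (Node n)) :
    Sat (forEach l M fun M p =>
        forEach l M fun M q =>
          if p = q then pure M else pure (addArc removed M p q)) (l.length + l.length * l.length)
      (IsTable (fun p q => q ∈ M p ∨ (inSet removed p = false ∧ inSet removed q = false ∧
        p ≠ q ∧ p ∈ l ∧ q ∈ l))
        (∑ p, (M p).length + l.length * l.length)) := by
  refine (sat_forEach
    (fun l' M' => (∀ p q, (q ∈ M' p ∨ (inSet removed p = false ∧ inSet removed q = false ∧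
        p ≠ q ∧ p ∈ l' ∧ q ∈ l)) ↔
        (q ∈ M p ∨ (inSet removed p = false ∧ inSet removed q = false ∧
        p ≠ q ∧ p ∈ l ∧ q ∈ l))) ∧
      ∑ p, (M' p).length + l'.length * l.length ≤ ∑ p, (M p).length + l.length * l.length)
    (fun _ => l.length) l ?_ M ⟨fun _ _ => Iff.rfl, le_rfl⟩).mono ?_ ?_
  · rintro r l' M' - ⟨h1, h2⟩
    refine (sat_forEach
      (fun l'' M'' => (∀ p q, (q ∈ M'' p ∨ (inSet removed p = false ∧ inSet removed q = false ∧
        p ≠ q ∧ p = r ∧ q ∈ l'')) ↔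
        (q ∈ M' p ∨ (inSet removed p = false ∧ inSet removed q = false ∧
        p ≠ q ∧ p = r ∧ q ∈ l))) ∧
      ∑ p, (M'' p).length + l''.length ≤ ∑ p, (M' p).length + l.length)
      (fun _ => 0) l ?_ M' ⟨fun _ _ => Iff.rfl, le_rfl⟩).mono (by simp) ?_
    · rintro s l'' M'' - ⟨h3, h4⟩
      rw [List.length_cons] at h4
      refine Sat.ite (fun hrs => Sat.pure ⟨fun p q => ?_, by omega⟩ _)
        fun hrs => Sat.pure ⟨fun p q => ?_, ?_⟩ _
      · rw [← h3 p q, List.mem_cons]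
        constructor
        · rintro (h | ⟨a, b, c, d, e⟩)
          exacts [Or.inl h, Or.inr ⟨a, b, c, d, Or.inr e⟩]
        · rintro (h | ⟨a, b, c, d, rfl | e⟩)
          exacts [Or.inl h, absurd (d.trans hrs) c, Or.inr ⟨a, b, c, d, e⟩]
      · rw [← h3 p q, List.mem_cons, mem_addArc]
        constructor
        · rintro ((h | ⟨rfl, rfl, a, b⟩) | ⟨a, b, c, d, e⟩)
          exacts [Or.inl h, Or.inr ⟨a, b, hrs, rfl, Or.inl rfl⟩, Or.inr ⟨a, b, c, d, Or.inr e⟩]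
        · rintro (h | ⟨a, b, c, d, e | e⟩)
          exacts [Or.inl (Or.inl h), Or.inl (Or.inr ⟨d, e, d ▸ a, e ▸ b⟩),
            Or.inr ⟨a, b, c, d, e⟩]
      · have := sum_length_addArc removed M'' r s
        omega
    · rintro M'' ⟨h3, h4⟩
      simp only [List.not_mem_nil, and_false, or_false] at h3
      refine ⟨fun p q => ?_, ?_⟩
      · rw [← h1 p q, h3 p q, List.mem_cons]
        constructor
        · rintro ((h | ⟨a, b, c, d, e⟩) | ⟨a, b, c, d, e⟩)
          exacts [Or.inl h, Or.inr ⟨a, b, c, Or.inl d, e⟩, Or.inr ⟨a, b, c, Or.inr d, e⟩]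
        · rintro (h | ⟨a, b, c, d | d, e⟩)
          exacts [Or.inl (Or.inl h), Or.inl (Or.inr ⟨a, b, c, d, e⟩), Or.inr ⟨a, b, c, d, e⟩]
      · simp only [List.length_nil, List.length_cons] at h2 h4
        have : (l'.length + 1) * l.length = l'.length * l.length + l.length := by ring
        omega
  · simp only [List.map_const', List.sum_replicate, smul_eq_mul]
    exact le_of_eq (by ring)
  · rintro M' ⟨h1, h2⟩
    exact ⟨fun p q => by simpa using h1 p q, by simpa using h2⟩

theorem length_filter_finRange (p : Fin n → Bool) :
    ((List.finRange n).filter p).length = ∑ a, if p a = true then 1 else 0 := by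
  rw [← List.toFinset_card_of_nodup ((List.nodup_finRange n).filter _), ← Finset.card_filter]
  congr 1
  ext a
  simp

theorem sum_inDegree (G : ADMG n) :
    ∑ c, ((List.finRange n).filter fun a => G.dir a c).length =
      (Finset.univ.filter fun e : Fin n × Fin n => G.dir e.1 e.2 = true).card := by
  simp only [length_filter_finRange, Finset.card_filter, Fintype.sum_prod_type_right]

/-- Handshaking: an edge between a and c is counted at both ends, once with the smaller and once
with the larger node first. -/
theorem sum_biDegree (G : ADMG n) :
    ∑ c, ((List.finRange n).filter fun b => G.bi b c).length =
      2 * (Finset.univ.filter fun e : Fin n × Fin n => e.1 < e.2 ∧ G.bi e.1 e.2 = true).card := by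
  have h : ∀ a c : Fin n, (if G.bi a c = true then 1 else 0) =
      (if a < c ∧ G.bi a c = true then 1 else 0) + if c < a ∧ G.bi c a = true then 1 else 0 := by
    intro a c
    rw [G.bi_symm c a]
    rcases lt_trichotomy a c with hac | rfl | hac
    · simp [hac, hac.not_gt]
    · simp [G.bi_irrefl]
    · simp [hac, hac.not_gt]
  simp only [length_filter_finRange, Finset.card_filter]
  rw [two_mul]
  nth_rewrite 1 [Fintype.sum_prod_type_right]
  rw [Fintype.sum_prod_type, ← Finset.sum_add_distrib]
  refine Finset.sum_congr rfl fun c _ => ?_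
  rw [← Finset.sum_add_distrib]
  exact Finset.sum_congr rfl fun a _ => h a c

theorem card_node : Fintype.card (Node n) ≤ n + n * n := by
  rw [Fintype.card_sum, Fintype.card_fin]
  refine Nat.add_le_add_left ?_ _
  have := Fintype.card_le_of_surjective (fun p : Fin n × Fin n => s(p.1, p.2)) fun e => by
    induction e with
    | h a b => exact ⟨(a, b), rfl⟩
  simpa using this

/-- Joining the parents of c costs the square of their number. One factor is at most 2n, and the
other sums over c to at most twice the number of edges, so the total is of order n times the number
of edges. -/
theorem sat_moralize (G : ADMG n) (removed : Finset (Fin n)) :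
    Sat (moralize G removed) (4 * n + 3 * n * n + 4 * G.numEdges + 4 * n * G.numEdges)
      (IsTable (MoralAdj G removed) (4 * G.numEdges + 4 * n * G.numEdges)) := by
  refine Sat.mono (Sat.bind (l := Fintype.card (Node n) +
    (n + (4 * G.numEdges + 4 * n * G.numEdges))) (sat_addLatents G) ?_) ?_ fun _ h => h
  · intro pa hpa
    have hpar : ∀ c p, p ∈ pa c ↔ G.ParentOf p c := by
      intro c p
      rw [hpa c]
      cases p with
      | inl a => simp [ADMG.ParentOf]
      | inr e =>
        change _ ↔ ∃ b, G.bi b c = true ∧ e = s(b, c)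
        simp [eq_comm (a := e)]
    have hlen : ∀ c, (pa c).length ≤ 2 * n := by
      intro c
      rw [hpa c, List.length_append, List.length_map, List.length_map]
      have h1 := List.length_filter_le (fun a => G.dir a c) (List.finRange n)
      have h2 := List.length_filter_le (fun a => G.bi a c) (List.finRange n)
      rw [List.length_finRange] at h1 h2
      omega
    have hsum : ∑ c, (pa c).length ≤ 2 * G.numEdges := by
      simp only [hpa, List.length_append, List.length_map, Finset.sum_add_distrib]
      rw [sum_inDegree, sum_biDegree, ADMG.numEdges]
      omega
    have hcost : ((List.finRange n).map fun c => 2 * (pa c).length +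
        (pa c).length * (pa c).length).sum ≤ 4 * G.numEdges + 4 * n * G.numEdges := by
      rw [← Fin.sum_univ_def]
      calc ∑ c, (2 * (pa c).length + (pa c).length * (pa c).length)
          ≤ ∑ c, (2 + 2 * n) * (pa c).length := Finset.sum_le_sum fun c _ => by
            have := Nat.mul_le_mul_right (pa c).length (hlen c)
            rw [Nat.add_mul]
            omega
        _ ≤ (2 + 2 * n) * (2 * G.numEdges) := by
            rw [← Finset.mul_sum]
            exact Nat.mul_le_mul_left _ hsum
        _ = _ := by ring
    refine Sat.charge_bind (Sat.mono (sat_forEach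
      (fun l M => (∀ p q, (q ∈ M p ∨ (inSet removed p = false ∧ inSet removed q = false ∧
        ∃ c ∈ l, FamilyAdj G.ParentOf c p q)) ↔ MoralAdj G removed p q) ∧
        ∑ p, (M p).length + (l.map fun c => 2 * (pa c).length +
        (pa c).length * (pa c).length).sum ≤ 4 * G.numEdges + 4 * n * G.numEdges)
      (fun c => 2 * (pa c).length + (pa c).length * (pa c).length) _ ?_ _ ⟨?_, ?_⟩) ?_ ?_)
    · rintro c l M - ⟨h1, h2⟩
      rw [List.map_cons, List.sum_cons] at h2
      refine Sat.mono (Sat.bind (sat_addChildArcs removed (pa c) c M) fun M' hM' => ?_)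
        (l := 2 * (pa c).length + (pa c).length * (pa c).length)
        (show (pa c).length + ((pa c).length + (pa c).length * (pa c).length) ≤ _ by omega)
        fun _ h => h
      obtain ⟨h3, h4⟩ := hM'
      refine (sat_addCoparentArcs removed (pa c) M').mono le_rfl ?_
      rintro M'' ⟨h5, h6⟩
      refine ⟨fun p q => ?_, by omega⟩
      rw [← h1 p q, h5 p q]
      simp only [h3, List.mem_cons, exists_eq_or_imp, FamilyAdj, hpar]
      by_cases ho : inSet removed p = false ∧ inSet removed q = false
      · simp only [ho.1, ho.2, true_and, or_assoc]
      · simp only [← and_assoc, ho, false_and, or_false]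
    · simp [MoralAdj]
    · simpa using hcost
    · rw [List.sum_map_add]
      simpa using hcost
    · rintro M ⟨h1, h2⟩
      exact ⟨fun p q => by simpa using h1 p q, by simpa using h2⟩
  · have := card_node (n := n)
    nlinarith

/-! ### Subgraphs -/

theorem numEdges_filterEdges_le (G : ADMG n) (p q : Fin n → Fin n → Bool) :
    (G.filterEdges p q).numEdges ≤ G.numEdges := by
  refine Nat.add_le_add (Finset.card_le_card fun e he => ?_) (Finset.card_le_card fun e he => ?_)
  · simp only [ADMG.filterEdges, Finset.mem_filter, Finset.mem_univ, true_and,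
      Bool.and_eq_true] at he ⊢
    exact he.1
  · simp only [ADMG.filterEdges, Finset.mem_filter, Finset.mem_univ, true_and,
      Bool.and_eq_true] at he ⊢
    exact ⟨he.1, he.2.1⟩

theorem dir_removeOut {G : ADMG n} {S : Finset (Fin n)} {a b : Fin n} :
    (G.removeOut S).dir a b = true ↔ G.dir a b = true ∧ a ∉ S := by
  simp [ADMG.removeOut, ADMG.filterEdges]

theorem bi_removeOut {G : ADMG n} {S : Finset (Fin n)} {a b : Fin n} :
    (G.removeOut S).bi a b = true ↔ G.bi a b = true := by
  simp [ADMG.removeOut, ADMG.filterEdges]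

theorem dir_removeIn {G : ADMG n} {S : Finset (Fin n)} {a b : Fin n} :
    (G.removeIn S).dir a b = true ↔ G.dir a b = true ∧ b ∉ S := by
  simp [ADMG.removeIn, ADMG.filterEdges]

theorem dir_induce {G : ADMG n} {W : Finset (Fin n)} {a b : Fin n} :
    (G.induce W).dir a b = true ↔ G.dir a b = true ∧ a ∈ W ∧ b ∈ W := by
  simp [ADMG.induce, ADMG.filterEdges]

theorem bi_induce {G : ADMG n} {W : Finset (Fin n)} {a b : Fin n} :
    (G.induce W).bi a b = true ↔ G.bi a b = true ∧ a ∈ W ∧ b ∈ W := by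
  simp [ADMG.induce, ADMG.filterEdges]

theorem dir_dropBi {G : ADMG n} {a b : Fin n} : G.dropBi.dir a b = G.dir a b := by
  simp [ADMG.dropBi, ADMG.filterEdges]

theorem bi_dropBi {G : ADMG n} {a b : Fin n} : G.dropBi.bi a b = false := by
  simp [ADMG.dropBi, ADMG.filterEdges]

/-! ### Searches in the moral graph -/

/-- The cost unit: up to a constant factor, the cost of building and searching the moral graph of
a graph with `n` nodes and at most `m` edges. -/
def costUnit (n m : ℕ) : ℕ := n * (n + m) + 1

theorem one_le_costUnit (n m : ℕ) : 1 ≤ costUnit n m := Nat.le_add_left _ _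

theorem sq_le_costUnit (n m : ℕ) : n * n ≤ costUnit n m := by
  rw [costUnit, Nat.mul_add]
  omega

theorem le_costUnit (n m : ℕ) : n ≤ costUnit n m :=
  (Nat.le_mul_self n).trans (sq_le_costUnit n m)

theorem mul_le_costUnit {n m k : ℕ} (h : k ≤ m) : n * k ≤ costUnit n m := by
  have := Nat.mul_le_mul_left n h
  rw [costUnit, Nat.mul_add]
  omega

theorem numEdges_le_costUnit {m : ℕ} {G : ADMG n} (h : G.numEdges ≤ m) :
    G.numEdges ≤ costUnit n m := by
  rcases Nat.eq_zero_or_pos n with rfl | hn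
  · simp [ADMG.numEdges]
  · exact (Nat.le_mul_of_pos_left _ hn).trans (mul_le_costUnit h)

/-- The adjacency lists of the moral graph of `G` without the nodes in `removed`. -/
def IsMoral (m : ℕ) (G : ADMG n) (removed : Finset (Fin n)) (M : Node n → List (Node n)) : Prop :=
  IsTable (MoralAdj G removed) (8 * costUnit n m) M

/-- Each of n, n², the number of edges and n times that number is at most one unit; hence 15 = 4 + 3
+ 4 + 4 here and 8 = 4 + 4 in `IsMoral`. -/
theorem sat_moralize_unit {m : ℕ} {G : ADMG n} (h : G.numEdges ≤ m) (removed : Finset (Fin n)) :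
    Sat (moralize G removed) (15 * costUnit n m) (IsMoral m G removed) := by
  have h1 := sq_le_costUnit n m
  have h2 := le_costUnit n m
  have h3 := mul_le_costUnit (n := n) h
  have h4 := numEdges_le_costUnit h
  refine (sat_moralize G removed).mono ?_ fun M hM => ⟨hM.1, hM.2.trans ?_⟩
  · rw [Nat.mul_assoc 3, Nat.mul_assoc 4 n]
    omega
  · rw [Nat.mul_assoc 4 n]
    omega

/-- A search that uses a part of the adjacency lists of a moral graph. -/
theorem sat_reachMoral {m : ℕ} {G : ADMG n} {removed : Finset (Fin n)}
    {M : Node n → List (Node n)} (hM : IsMoral m G removed M) {nbrs : Node n → Timed (List (Node n))}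
    {f : Node n → List (Node n)} (hf : ∀ p, Sat (nbrs p) 0 fun l => l = f p)
    (hle : ∀ p, (f p).length ≤ (M p).length) {start : List (Node n)} (hs : start.Nodup) :
    Sat (reach nbrs start) (14 * costUnit n m)
      fun S => ∀ v, v ∈ S ↔ ∃ u ∈ start, ReflTransGen (fun a b => b ∈ f a) u v := by
  -- 14 = 3 · 2 + 8: the node table, the start list and the expansions each cost at most the number
  -- of nodes, which is at most two units; the adjacency lists have at most 8 units of entries.
  refine (sat_reach hf hs).mono ?_ fun _ h => h
  have h1 := sq_le_costUnit n m
  have h2 := le_costUnit n m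
  have h3 := card_node (n := n)
  have h4 := hs.length_le_card
  have h5 : ∑ p, (1 + 0 + (f p).length) ≤ Fintype.card (Node n) + ∑ p, (M p).length := by
    rw [Finset.sum_add_distrib]
    refine Nat.add_le_add (by simp) (Finset.sum_le_sum fun p _ => hle p)
  have h6 := hM.2
  omega

theorem sat_testSep_moral {m : ℕ} {G : ADMG n} (h : G.numEdges ≤ m) (A B C : Finset (Fin n)) :
    Sat (testSep G A B C) (50 * costUnit n m) fun r => ∃ W : Finset (Fin n),
      (∀ v, v ∈ W ↔ ∃ d ∈ A ∪ B ∪ C, G.IsDescendant v d) ∧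
      (r = true ↔ ¬ ∃ a ∈ A \ C, ∃ b ∈ B,
        ReflTransGen (MoralAdj (G.induce W) C) (Sum.inl a) (Sum.inl b)) := by
  have h1 := sq_le_costUnit n m
  have h2 := le_costUnit n m
  refine Sat.mono (k := n + ((4 * n + 2 * n * n) + (2 * n * n + (15 * costUnit n m +
    (n + (n + (14 * costUnit n m + (n + 0)))))))) ?_ ?_ fun _ h => h
  · refine Sat.bind (sat_storeSet _) ?_
    rintro _ rfl
    refine Sat.bind (sat_ancestors G _) fun W hW => ?_
    refine Sat.bind (sat_storeGraph _) ?_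
    rintro _ rfl
    refine Sat.bind (sat_moralize_unit ((numEdges_filterEdges_le _ _ _).trans h) C) fun M hM => ?_
    refine Sat.bind (sat_storeSet _) ?_
    rintro _ rfl
    refine Sat.bind (sat_listSet _) ?_
    rintro l ⟨hl, hl'⟩
    refine Sat.bind (sat_reachMoral hM (f := M)
      (fun p => Sat.pure (P := fun l => l = M p) rfl 0) (fun _ => le_rfl)
      (hl.map Sum.inl_injective)) fun S hS => ?_
    refine Sat.bind ((sat_scan _ _).mono (by simp) fun _ h => h) ?_
    rintro _ rfl
    refine Sat.pure ⟨W, hW, ?_⟩ 0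
    have hrel : (fun a b => b ∈ M a) = MoralAdj (G.induce W) C := by
      funext a b
      exact propext (hM.1 a b)
    rw [hrel] at hS
    simp only [List.isEmpty_iff, List.filter_eq_nil_iff, List.mem_finRange, true_imp_iff,
      Bool.and_eq_true, decide_eq_true_eq, hS, List.mem_map, ← hl', List.mem_toFinset]
    constructor
    · rintro h ⟨a, ha, b, hb, hab⟩
      exact h b ⟨hb, _, ⟨a, ha, rfl⟩, hab⟩
    · rintro h b ⟨hb, _, ⟨a, ha, rfl⟩, hab⟩
      exact h ⟨a, ha, b, hb, hab⟩
  · rw [Nat.mul_assoc 2]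
    omega

/-- `p` is joined to the observed node `u` by a walk whose interior nodes are latent or `u`. -/
def LatentReach (G : ADMG n) (removed : Finset (Fin n)) (u : Fin n) : Node n → Prop :=
  ReflTransGen (fun p q => (p = Sum.inl u ∨ p.isRight = true) ∧ MoralAdj G removed p q) (Sum.inl u)

theorem sat_getNeighbors {m : ℕ} {G : ADMG n} {removed : Finset (Fin n)}
    {M : Node n → List (Node n)} (hM : IsMoral m G removed M) (u : Fin n) :
    Sat (getNeighbors u M) (15 * costUnit n m)
      fun A => ∀ w, w ∈ A ↔ w ≠ u ∧ LatentReach G removed u (Sum.inl w) := by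
  have h2 := le_costUnit n m
  refine Sat.mono (Sat.bind (l := n) (sat_reachMoral hM (start := [Sum.inl u])
    (f := fun p => if p = Sum.inl u ∨ p.isRight = true then M p else []) (fun p => ?_)
    (fun p => ?_) (List.nodup_singleton _)) fun S hS => ?_)
    (show 14 * costUnit n m + n ≤ 15 * costUnit n m by omega) fun _ h => h
  · cases p with
    | inl v =>
      by_cases hv : v = u
      · simp only [hv, if_true]
        exact Sat.pure (by simp) 0
      · simp only [hv, if_false]
        exact Sat.pure (by simp [hv]) 0
    | inr e => exact Sat.pure (by simp) 0
  · split_ifs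
    · exact le_rfl
    · exact Nat.zero_le _
  · refine (sat_storeSet _).mono le_rfl ?_
    rintro _ rfl w
    have hrel : (fun p q => q ∈ if p = Sum.inl u ∨ p.isRight = true then M p else []) =
        fun p q => (p = Sum.inl u ∨ p.isRight = true) ∧ MoralAdj G removed p q := by
      funext p q
      by_cases hp : p = Sum.inl u ∨ p.isRight = true
      · simp [hp, hM.1 p q]
      · simp [hp]
    rw [Finset.mem_filter, hS, hrel]
    simp [LatentReach]

/-! ### Active walks -/

/-- `v` is an ancestor of `C`. -/
def ADMG.Anc (G : ADMG n) (C : Finset (Fin n)) (v : Fin n) : Prop :=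
  ∃ d ∈ C, G.IsDescendant v d

theorem ADMG.Anc.of_mem {G : ADMG n} {C : Finset (Fin n)} {v : Fin n} (h : v ∈ C) : G.Anc C v :=
  ⟨v, h, ReflTransGen.refl⟩

theorem ADMG.Anc.of_dir {G : ADMG n} {C : Finset (Fin n)} {a v : Fin n} (h : G.Anc C v)
    (hav : G.dir a v = true) : G.Anc C a := by
  obtain ⟨d, hd, hvd⟩ := h
  exact ⟨d, hd, ReflTransGen.head hav hvd⟩

theorem ADMG.HasEdge.ne {G : ADMG n} {k : EdgeKind} {u w : Fin n} (h : G.HasEdge k u w) :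
    u ≠ w := by
  rintro rfl
  cases k with
  | fwd => exact G.acyclic u (TransGen.single h)
  | bwd => exact G.acyclic u (TransGen.single h)
  | both => exact absurd h (by simp [ADMG.HasEdge, G.bi_irrefl])

/-- There is a walk from `A` to a node that is not blocked by `C` at any node but possibly the
last one; the proposition tells whether its last edge has an arrowhead at the last node. -/
inductive Conn (G : ADMG n) (A C : Finset (Fin n)) : Prop → Fin n → Prop
  | start {a : Fin n} : a ∈ A → Conn G A C False a
  | step {h : Prop} {u w : Fin n} {k : EdgeKind} : Conn G A C h u → G.HasEdge k u w →
      (h ∧ k.HeadLeft → G.Anc C u) → (¬ (h ∧ k.HeadLeft) → u ∉ C) → Conn G A C k.HeadRight w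

/-- The node with index `i` has arrowheads of the edges before and after it. -/
def HeadToHead (e : ℕ → EdgeKind) (i : ℕ) : Prop :=
  0 < i ∧ (e (i - 1)).HeadRight ∧ (e i).HeadLeft

theorem isCollider_iff {len : ℕ} {e : ℕ → EdgeKind} {i : ℕ} :
    IsCollider len e i ↔ i < len ∧ HeadToHead e i := by
  unfold IsCollider HeadToHead
  tauto

/-- The length does not occur, so this condition passes to initial segments of a path. -/
def ActiveAt (G : ADMG n) (C : Finset (Fin n)) (p : ℕ → Fin n) (e : ℕ → EdgeKind) (i : ℕ) : Prop :=
  (HeadToHead e i → G.Anc C (p i)) ∧ (¬ HeadToHead e i → p i ∉ C)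

theorem not_headLeft {k : EdgeKind} (h : ¬ k.HeadLeft) : k = .fwd := by
  cases k <;> simp_all [EdgeKind.HeadLeft]

theorem not_headRight {k : EdgeKind} (h : ¬ k.HeadRight) : k = .bwd := by
  cases k <;> simp_all [EdgeKind.HeadRight]

/-- Starting with a forward edge, the path runs forward until it meets a collider, which is an
ancestor of `C`, or until it ends with an arrowhead. -/
theorem anc_or_headRight {G : ADMG n} {C : Finset (Fin n)} {len : ℕ} {p : ℕ → Fin n}
    {e : ℕ → EdgeKind} (hp : ∀ i, i < len → G.HasEdge (e i) (p i) (p (i + 1)))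
    (hact : ∀ i, i < len → ActiveAt G C p e i) {i : ℕ} (hi : i < len) (hei : e i = .fwd) :
    G.Anc C (p i) ∨ (e (len - 1)).HeadRight := by
  induction hd : len - i generalizing i with
  | zero => omega
  | succ d ih =>
    by_cases hl : i + 1 = len
    · right
      rw [show len - 1 = i by omega, hei]
      trivial
    · have hdir : G.dir (p i) (p (i + 1)) = true := by
        have := hp i hi
        rw [hei] at this
        exact this
      by_cases hc : HeadToHead e (i + 1)
      · exact Or.inl (((hact (i + 1) (by omega)).1 hc).of_dir hdir)
      · have : e (i + 1) = .fwd := by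
          refine not_headLeft fun h => hc ⟨Nat.succ_pos _, ?_, h⟩
          rw [Nat.add_sub_cancel, hei]
          trivial
        exact (ih (by omega) this (by omega)).imp_left fun h => h.of_dir hdir

/-- A walk can be shortened to a path. If this changes the kind of the last arrow, then the path
can nevertheless be continued by the same edges. -/
theorem Conn.exists_path {G : ADMG n} {A C : Finset (Fin n)} {h : Prop} {w : Fin n}
    (hw : Conn G A C h w) : ∃ len p e, G.IsPath len p e ∧ p 0 ∈ A ∧ p len = w ∧
      (∀ i, i < len → ActiveAt G C p e i) ∧
      (0 < len ∧ (e (len - 1)).HeadRight → ¬ h → G.Anc C w) ∧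
      (¬ (0 < len ∧ (e (len - 1)).HeadRight) → h → w ∉ C) := by
  induction hw with
  | @start a ha =>
    exact ⟨0, fun _ => a, fun _ => .fwd, ⟨fun i hi => absurd hi (Nat.not_lt_zero _),
      fun i j hi hj _ => by omega⟩, ha, rfl, fun i hi => absurd hi (Nat.not_lt_zero _),
      fun h => absurd h.1 (Nat.lt_irrefl _), fun _ h => h.elim⟩
  | @step h u w k _ hk h1 h2 ih =>
    obtain ⟨len, p, e, hp, hp0, hpl, hact, h3, h4⟩ := ih
    by_cases hex : ∃ i, i ≤ len ∧ p i = w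
    · obtain ⟨i, hi, hpi⟩ := hex
      have hil : i < len := by
        refine lt_of_le_of_ne hi fun hil => ?_
        rw [hil, hpl] at hpi
        exact hk.ne hpi
      -- The path already visits `w`, so it is cut there and the new edge is dropped.
      refine ⟨i, p, e, ⟨fun j hj => hp.edge j (by omega),
        fun j l hj hl => hp.inj j l (by omega) (by omega)⟩, hp0, hpi,
        fun j hj => hact j (by omega), ?_, ?_⟩
      -- The dropped edge is w → u, while the cut path enters w with an arrowhead. If w is not a
      -- collider of the old path, that path leaves w forward: either this shows that w is an
      -- ancestor of `C`, or the old path enters u with an arrowhead. Then u is an ancestor of `C`,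
      -- and so is w through w → u.
      · rintro ⟨hi0, hir⟩ hkr
        rw [not_headRight hkr] at hk h1
        by_cases hc : HeadToHead e i
        · exact hpi ▸ (hact i hil).1 hc
        · have hei : e i = .fwd := not_headLeft fun h => hc ⟨hi0, hir, h⟩
          rcases anc_or_headRight hp.edge hact hil hei with h | hr
          · exact hpi ▸ h
          · have hu : G.Anc C u := by
              by_cases hh : h
              · exact h1 ⟨hh, trivial⟩
              · exact h3 ⟨by omega, hr⟩ hh
            exact hu.of_dir hk
      · intro hi' _
        rw [← hpi]
        exact (hact i hil).2 fun hc => hi' ⟨hc.1, hc.2.1⟩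
    · push Not at hex
      refine ⟨len + 1, fun j => if j ≤ len then p j else w, fun j => if j < len then e j else k,
        ⟨?_, ?_⟩, by simpa using hp0, by simp, ?_, ?_, ?_⟩
      · intro i hi
        rcases Nat.lt_succ_iff_lt_or_eq.1 hi with hi | rfl
        · simpa [hi, hi.le, Nat.succ_le_of_lt hi] using hp.edge i hi
        · simpa [hpl] using hk
      · intro i j hi hj hij
        by_cases hi' : i ≤ len <;> by_cases hj' : j ≤ len <;> simp only [hi', hj', if_true,
          if_false] at hij
        · exact hp.inj i j hi' hj' hij
        · exact absurd hij (hex i hi')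
        · exact absurd hij.symm (hex j hj')
        · omega
      · intro i hi
        rcases Nat.lt_succ_iff_lt_or_eq.1 hi with hi | rfl
        · have := hact i hi
          simpa [ActiveAt, HeadToHead, hi, hi.le, show i - 1 < len by omega] using this
        · have hiff : HeadToHead (fun j => if j < i then e j else k) i ↔
              (0 < i ∧ (e (i - 1)).HeadRight) ∧ k.HeadLeft := by
            unfold HeadToHead
            by_cases h0 : 0 < i
            · simp [h0]
            · simp [h0]
          -- The node u may be a collider on the path but not on the walk, or conversely; `h3` and
          -- `h4` cover these two cases.
          unfold ActiveAt
          rw [hiff]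
          simp only [le_refl, if_true, hpl]
          constructor
          · rintro ⟨ha, hb⟩
            by_cases hh : h
            · exact h1 ⟨hh, hb⟩
            · exact h3 ha hh
          · intro hn
            by_cases hb : k.HeadLeft
            · by_cases hh : h
              · exact h4 (fun ha => hn ⟨ha, hb⟩) hh
              · exact h2 fun h => hh h.1
            · exact h2 fun h => hb h.2
      · intro h5 h6
        simp at h5
        exact absurd h5 h6
      · intro h5 h6
        simp at h5
        exact absurd h6 h5

theorem not_blocked_iff {G : ADMG n} {C : Finset (Fin n)} {len : ℕ} {p : ℕ → Fin n}
    {e : ℕ → EdgeKind} : ¬ G.Blocked C len p e ↔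
      (∀ i, i < len → ActiveAt G C p e i) ∧ p len ∉ C := by
  unfold ADMG.Blocked
  simp only [isCollider_iff]
  push Not
  constructor
  · intro h
    refine ⟨fun i hi => ⟨fun hc => ?_, fun hc => (h i hi.le).2 fun _ => hc⟩, ?_⟩
    · exact (h i hi.le).1 ⟨hi, hc⟩
    · exact (h len le_rfl).2 fun h => absurd h (lt_irrefl _)
  · rintro ⟨h1, h2⟩ i hi
    refine ⟨fun hc => (h1 i hc.1).1 hc.2, fun hc => ?_⟩
    rcases hi.lt_or_eq with hi | rfl
    · exact (h1 i hi).2 (hc hi)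
    · exact h2

theorem Conn.mem_of_isSeparator {G : ADMG n} {A B C : Finset (Fin n)} {h : Prop} {b : Fin n}
    (hb : Conn G A C h b) (hsep : G.IsSeparator A B C) (hbB : b ∈ B) : b ∈ C := by
  by_contra hbC
  obtain ⟨len, p, e, hp, hp0, rfl, hact, -, -⟩ := hb.exists_path
  exact not_blocked_iff.2 ⟨hact, hbC⟩ (hsep len p e hp hp0 hbB)

/-- There is a walk as in `Conn` that can be continued by an edge with an arrowhead at `u`. -/
def ConnHead (G : ADMG n) (A C : Finset (Fin n)) (u : Fin n) : Prop :=
  ∃ h, Conn G A C h u ∧ (h → G.Anc C u) ∧ (¬ h → u ∉ C)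

/-! ### Continuing active walks when a separator is given. -/

section Conn

variable {G : ADMG n} {A B C : Finset (Fin n)}

theorem Conn.fwd {h : Prop} {u w : Fin n} (hu : Conn G A C h u) (huC : u ∉ C)
    (huw : G.dir u w = true) : Conn G A C True w :=
  Conn.step (k := .fwd) hu huw (fun h => h.2.elim) fun _ => huC

theorem ConnHead.step {k : EdgeKind} {u w : Fin n} (hu : ConnHead G A C u)
    (hk : k.HeadLeft) (huw : G.HasEdge k u w) : Conn G A C k.HeadRight w := by
  obtain ⟨h, h1, h2, h3⟩ := hu
  exact Conn.step h1 huw (fun h => h2 h.1) fun h => h3 fun h' => h ⟨h', hk⟩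

theorem ConnHead.bwd {u w : Fin n} (hu : ConnHead G A C u) (huw : G.dir w u = true) :
    Conn G A C False w :=
  hu.step (k := .bwd) trivial huw

theorem ConnHead.both {u w : Fin n} (hu : ConnHead G A C u) (huw : G.bi u w = true) :
    Conn G A C True w :=
  hu.step (k := .both) trivial huw

theorem Conn.forward {h : Prop} {c d : Fin n} (hc : Conn G A C h c)
    (hcd : ReflTransGen (fun a b => G.dir a b = true ∧ a ∉ C) c d) : ∃ h', Conn G A C h' d := by
  induction hcd with
  | refl => exact ⟨h, hc⟩
  | tail _ hbc ih =>
    obtain ⟨h', hb⟩ := ih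
    exact ⟨True, hb.fwd hbc.2 hbc.1⟩

theorem ConnHead.backward {c d : Fin n} (hd : ConnHead G A C d)
    (hcd : ReflTransGen (fun a b => G.dir a b = true ∧ a ∉ C) c d) : ConnHead G A C c := by
  induction hcd using ReflTransGen.head_induction_on with
  | refl => exact hd
  | head hab _ ih => exact ⟨False, ih.bwd hab.1, fun h => h.elim, fun _ => hab.2⟩

theorem reflTransGen_of_not_anc {c d : Fin n} (hc : ¬ G.Anc C c) (hcd : G.IsDescendant c d) :
    ReflTransGen (fun a b => G.dir a b = true ∧ a ∉ C) c d := by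
  induction hcd with
  | refl => exact ReflTransGen.refl
  | @tail a b hca hab ih => exact ih.tail ⟨hab, fun h => hc ⟨a, h, hca⟩⟩

/-- If c is an ancestor of `C`, it is open as a collider. Otherwise it has a directed path avoiding
`C` to some d in `A` or `B`. If d is in `A`, a new walk starts at d and goes back to c, so that c is
no collider. If d is in `B`, the given walk goes on to d, against separation. -/
theorem Conn.connHead (hsep : G.IsSeparator A B C) {h : Prop} {c : Fin n} (hc : Conn G A C h c)
    (hhc : ¬ h → c ∉ C) (hW : G.Anc (A ∪ B ∪ C) c) : ConnHead G A C c := by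
  by_cases hanc : G.Anc C c
  · exact ⟨h, hc, fun _ => hanc, hhc⟩
  · obtain ⟨d, hd, hcd⟩ := hW
    have hdC : d ∉ C := fun h => hanc ⟨d, h, hcd⟩
    have hcd' := reflTransGen_of_not_anc hanc hcd
    simp only [Finset.mem_union, hdC, or_false] at hd
    rcases hd with hd | hd
    · exact ConnHead.backward ⟨False, Conn.start hd, fun h => h.elim, fun _ => hdC⟩ hcd'
    · obtain ⟨h', hd'⟩ := hc.forward hcd'
      exact absurd (hd'.mem_of_isSeparator hsep hd) hdC

/-! ### Separation in the moral graph -/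

theorem inSet_inl {S : Finset (Fin n)} {v : Fin n} : inSet S (Sum.inl v) = false ↔ v ∉ S := by
  simp [inSet]

/-- A node of the moral graph is reached by active walks. -/
def NodeConn (G : ADMG n) (A C : Finset (Fin n)) : Node n → Prop
  | Sum.inl w => w ∉ C ∧ ∃ h, Conn G A C h w
  | Sum.inr e => ∀ a ∈ e, ConnHead G A C a

theorem ADMG.ParentOf.mem_induce {W : Finset (Fin n)} {q : Node n} {c : Fin n}
    (h : (G.induce W).ParentOf q c) : c ∈ W := by
  cases q with
  | inl a => exact (dir_induce.1 h).2.2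
  | inr e =>
    obtain ⟨b, hb, -⟩ := h
    exact (bi_induce.1 hb).2.2

/-- A marriage of two parents is traversed as p → c ← q, where `Conn.connHead` opens c. For a latent
q both of its children are needed: from c the bidirected edge leads to the other child, which is
opened in turn. -/
theorem nodeConn_of_moralAdj (hsep : G.IsSeparator A B C) {W : Finset (Fin n)}
    (hW : ∀ c ∈ W, G.Anc (A ∪ B ∪ C) c) {p q : Node n} (hp : NodeConn G A C p)
    (hpq : MoralAdj (G.induce W) C p q) : NodeConn G A C q := by
  have toChild : ∀ {p c}, NodeConn G A C p → (G.induce W).ParentOf p c → ConnHead G A C c := by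
    intro p c hp hpc
    have hc := hW c hpc.mem_induce
    cases p with
    | inl w =>
      obtain ⟨hw, h, hw'⟩ := hp
      exact (hw'.fwd hw (dir_induce.1 hpc).1).connHead hsep (fun h => absurd trivial h) hc
    | inr e =>
      obtain ⟨b, -, rfl⟩ := hpc
      exact hp c (Sym2.mem_mk_right b c)
  have toParent : ∀ {q c}, ConnHead G A C c → (G.induce W).ParentOf q c → inSet C q = false →
      NodeConn G A C q := by
    intro q c hc hqc hq
    cases q with
    | inl w => exact ⟨inSet_inl.1 hq, False, hc.bwd (dir_induce.1 hqc).1⟩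
    | inr e =>
      obtain ⟨b, hb, rfl⟩ := hqc
      obtain ⟨hb, hbW, hcW⟩ := bi_induce.1 hb
      intro a ha
      rcases Sym2.mem_iff.1 ha with rfl | rfl
      · exact (hc.both (by rw [G.bi_symm, hb])).connHead hsep (fun h => absurd trivial h)
          (hW _ hbW)
      · exact hc
  obtain ⟨h1, h2, c, ⟨hpc, rfl⟩ | ⟨rfl, hqc⟩ | ⟨-, hpc, hqc⟩⟩ := hpq
  · obtain ⟨h, hc, -, -⟩ := toChild hp hpc
    exact ⟨inSet_inl.1 h2, h, hc⟩
  · obtain ⟨hpC, h, hp⟩ := hp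
    exact toParent (hp.connHead hsep (fun _ => hpC) (hW _ hqc.mem_induce)) hqc h2
  · exact toParent (toChild hp hpc) hqc h2

theorem not_moralReach_of_isSeparator (hsep : G.IsSeparator A B C) {W : Finset (Fin n)}
    (hW : ∀ c ∈ W, G.Anc (A ∪ B ∪ C) c) {a b : Fin n} (ha : a ∈ A) (haC : a ∉ C) (hb : b ∈ B) :
    ¬ ReflTransGen (MoralAdj (G.induce W) C) (Sum.inl a) (Sum.inl b) := by
  intro hab
  have hconn : ∀ q, ReflTransGen (MoralAdj (G.induce W) C) (Sum.inl a) q → NodeConn G A C q := by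
    intro q hq
    induction hq with
    | refl => exact ⟨haC, False, Conn.start ha⟩
    | tail _ hpq ih => exact nodeConn_of_moralAdj hsep hW ih hpq
  obtain ⟨hbC, h, hb'⟩ := hconn _ hab
  exact hbC (hb'.mem_of_isSeparator hsep hb)

/-- A node that is not a collider is an end or has an outgoing edge of the path. Following edges in
that direction (`right` or `left`), one arrives at a collider or at an end, both ancestors of `S`.
-/
theorem anc_of_active {S : Finset (Fin n)} {len : ℕ} {p : ℕ → Fin n} {e : ℕ → EdgeKind}
    (hp : G.IsPath len p e) (h0 : p 0 ∈ S) (hl : p len ∈ S)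
    (hact : ∀ i, i < len → HeadToHead e i → G.Anc S (p i)) {i : ℕ} (hi : i ≤ len) :
    G.Anc S (p i) := by
  have right : ∀ d i, i + d = len → (i < len → e i = .fwd) → G.Anc S (p i) := by
    intro d
    induction d with
    | zero => rintro i rfl -; exact ADMG.Anc.of_mem hl
    | succ d ih =>
      intro i hid he
      have hi : i < len := by omega
      have hdir : G.dir (p i) (p (i + 1)) = true := by
        have := hp.edge i hi
        rw [he hi] at this
        exact this
      refine ADMG.Anc.of_dir ?_ hdir
      by_cases hc : i + 1 < len ∧ HeadToHead e (i + 1)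
      · exact hact _ hc.1 hc.2
      · refine ih (i + 1) (by omega) fun hlt => not_headLeft fun h => hc ⟨hlt, Nat.succ_pos _, ?_, h⟩
        rw [Nat.add_sub_cancel, he hi]
        trivial
  have left : ∀ i, i ≤ len → (0 < i → e (i - 1) = .bwd) → G.Anc S (p i) := by
    intro i
    induction i with
    | zero => exact fun _ _ => ADMG.Anc.of_mem h0
    | succ i ih =>
      intro hi he
      have he' : e i = .bwd := he (Nat.succ_pos _)
      have hdir : G.dir (p (i + 1)) (p i) = true := by
        have := hp.edge i hi
        rw [he'] at this
        exact this
      refine ADMG.Anc.of_dir ?_ hdir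
      by_cases hc : HeadToHead e i
      · exact hact _ hi hc
      · refine ih (by omega) fun hlt => not_headRight fun h => hc ⟨hlt, h, ?_⟩
        rw [he']
        trivial
  by_cases hr : i < len → e i = .fwd
  · exact right (len - i) i (by omega) hr
  · push Not at hr
    by_cases hc : HeadToHead e i
    · exact hact i hr.1 hc
    · refine left i hi fun h => not_headRight fun h' => hc ⟨h, h', ?_⟩
      by_contra h''
      exact hr.2 (not_headLeft h'')

theorem isSeparator_of_not_moralReach {W : Finset (Fin n)}
    (hW : ∀ c, G.Anc (A ∪ B ∪ C) c → c ∈ W)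
    (h : ∀ a ∈ A, a ∉ C → ∀ b ∈ B,
      ¬ ReflTransGen (MoralAdj (G.induce W) C) (Sum.inl a) (Sum.inl b)) :
    G.IsSeparator A B C := by
  intro len p e hp hp0 hpl
  by_contra hblock
  obtain ⟨hact, hlC⟩ := not_blocked_iff.1 hblock
  have hmem : ∀ i, i ≤ len → p i ∈ W := fun i hi =>
    hW _ (anc_of_active hp (by simp [hp0]) (by simp [hpl]) (fun i hi hc => by
      obtain ⟨d, hd, hid⟩ := (hact i hi).1 hc
      exact ⟨d, by simp [hd], hid⟩) hi)
  set H := G.induce W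
  set R := ReflTransGen (MoralAdj H C) (Sum.inl (p 0)) with hR
  have h0C : p 0 ∉ C := by
    rcases Nat.eq_zero_or_pos len with rfl | hpos
    · exact hlC
    · exact (hact 0 hpos).2 fun h => absurd h.1 (lt_irrefl _)
  -- A collider may lie in `C` and be missing from the moral graph. The search then bypasses it from
  -- one parent to the next, so after an arrowhead the induction retains a reached parent outside
  -- `C`.
  have main : ∀ i, i ≤ len → (0 < i ∧ (e (i - 1)).HeadRight →
      ∃ q, H.ParentOf q (p i) ∧ inSet C q = false ∧ R q) ∧ (p i ∉ C → R (Sum.inl (p i))) := by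
    intro i
    induction i with
    | zero => exact fun _ => ⟨fun h => absurd h.1 (lt_irrefl _), fun _ => ReflTransGen.refl⟩
    | succ i ih =>
      intro hi
      obtain ⟨ih1, ih2⟩ := ih (by omega)
      have hiW := hmem i (by omega)
      have hiW' := hmem (i + 1) hi
      have hedge := hp.edge i hi
      have parent : ∀ q, (e i).HeadLeft → H.ParentOf q (p i) → inSet C q = false → R q := by
        intro q hl hq hqC
        by_cases hc : HeadToHead e i
        · obtain ⟨q', h1, h2, h3⟩ := ih1 ⟨hc.1, hc.2.1⟩
          by_cases hqq : q' = q
          · exact hqq ▸ h3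
          · exact h3.tail ⟨h2, hqC, p i, Or.inr (Or.inr ⟨hqq, h1, hq⟩)⟩
        · have hiC := (hact i hi).2 hc
          exact (ih2 hiC).tail ⟨inSet_inl.2 hiC, hqC, p i, Or.inr (Or.inl ⟨rfl, hq⟩)⟩
      have child : ∀ q, H.ParentOf q (p (i + 1)) → inSet C q = false → R q →
          p (i + 1) ∉ C → R (Sum.inl (p (i + 1))) := fun q h1 h2 h3 h4 =>
        h3.tail ⟨h2, inSet_inl.2 h4, p (i + 1), Or.inl ⟨h1, rfl⟩⟩
      rw [Nat.add_sub_cancel]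
      cases hk : e i with
      | fwd =>
        rw [hk] at hedge
        have hiC : p i ∉ C := (hact i hi).2 fun hc => by
          have := hc.2.2
          rw [hk] at this
          exact this
        have hpar : H.ParentOf (Sum.inl (p i)) (p (i + 1)) := dir_induce.2 ⟨hedge, hiW, hiW'⟩
        have hiC' := inSet_inl.2 hiC
        exact ⟨fun _ => ⟨_, hpar, hiC', ih2 hiC⟩, child _ hpar hiC' (ih2 hiC)⟩
      | bwd =>
        rw [hk] at hedge
        refine ⟨fun h => h.2.elim, fun hC => parent _ (by rw [hk]; trivial) ?_ (inSet_inl.2 hC)⟩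
        exact dir_induce.2 ⟨hedge, hiW', hiW⟩
      | both =>
        rw [hk] at hedge
        have hpar : H.ParentOf (Sum.inr s(p i, p (i + 1))) (p (i + 1)) :=
          ⟨p i, bi_induce.2 ⟨hedge, hiW, hiW'⟩, rfl⟩
        have hpar' : H.ParentOf (Sum.inr s(p i, p (i + 1))) (p i) :=
          ⟨p (i + 1), bi_induce.2 ⟨by rw [G.bi_symm]; exact hedge, hiW', hiW⟩, Sym2.eq_swap⟩
        have hreach := parent _ (by rw [hk]; trivial) hpar' rfl
        exact ⟨fun _ => ⟨_, hpar, rfl, hreach⟩, child _ hpar rfl hreach⟩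
  exact h (p 0) hp0 h0C (p len) hpl ((main len le_rfl).2 hlC)

end Conn

theorem sat_testSep {m : ℕ} {G : ADMG n} (h : G.numEdges ≤ m) (A B C : Finset (Fin n)) :
    Sat (testSep G A B C) (50 * costUnit n m) fun r => r = true ↔ G.IsSeparator A B C := by
  refine (sat_testSep_moral h A B C).mono le_rfl ?_
  rintro r ⟨W, hW, hr⟩
  rw [hr]
  constructor
  · intro h
    refine isSeparator_of_not_moralReach (fun c hc => (hW c).2 hc) fun a ha haC b hb hab => ?_
    exact h ⟨a, Finset.mem_sdiff.2 ⟨ha, haC⟩, b, hb, hab⟩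
  · rintro hsep ⟨a, ha, b, hb, hab⟩
    rw [Finset.mem_sdiff] at ha
    exact not_moralReach_of_isSeparator hsep (fun c hc => (hW c).1 hc) ha.1 ha.2 hb hab

/-! ### The second condition of the search: `GetDep` -/

/-- All back-door paths from `Z` to `Y` are blocked by `X`. -/
def BackdoorSep (G : ADMG n) (X Y Z : Finset (Fin n)) : Prop :=
  (G.removeOut Z).IsSeparator Z Y X

theorem removeOut_induce (G : ADMG n) (S W : Finset (Fin n)) :
    (G.induce W).removeOut S = (G.removeOut S).induce W := by
  simp only [ADMG.removeOut, ADMG.induce, ADMG.filterEdges, ADMG.mk.injEq]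
  constructor
  · funext a b
    simp only [Bool.and_assoc, Bool.and_comm, Bool.and_left_comm]
  · funext a b
    simp only [Bool.and_true]

theorem isDescendant_of_removeOut {G : ADMG n} {S : Finset (Fin n)} {a d : Fin n}
    (h : (G.removeOut S).IsDescendant a d) : G.IsDescendant a d :=
  ReflTransGen.mono (fun _ _ h => (dir_removeOut.1 h).1) _ _ h

/-- Stopping at the first node of `S`, one gets an ancestor in the graph without edges out of
`S`. -/
theorem ADMG.Anc.removeOut {G : ADMG n} {S D : Finset (Fin n)} (hSD : S ⊆ D) {c : Fin n}
    (h : G.Anc D c) : (G.removeOut S).Anc D c := by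
  obtain ⟨d, hd, hcd⟩ := h
  induction hcd using ReflTransGen.head_induction_on with
  | refl => exact ADMG.Anc.of_mem hd
  | @head a b hab _ ih =>
    by_cases ha : a ∈ S
    · exact ADMG.Anc.of_mem (hSD ha)
    · exact ih.of_dir (dir_removeOut.2 ⟨hab, ha⟩)

theorem MoralAdj.mono {H H' : ADMG n} {C : Finset (Fin n)} {p q : Node n}
    (h : MoralAdj H C p q) (hp : ∀ c, H.ParentOf p c → H'.ParentOf p c)
    (hq : ∀ c, H.ParentOf q c → H'.ParentOf q c) : MoralAdj H' C p q := by
  obtain ⟨h1, h2, c, h3⟩ := h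
  exact ⟨h1, h2, c, h3.imp (fun h => ⟨hp c h.1, h.2⟩)
    (Or.imp (fun h => ⟨h.1, hq c h.2⟩) fun h => ⟨h.1, hp c h.2.1, hq c h.2.2⟩)⟩

theorem parentOf_removeOut {G : ADMG n} {S S' : Finset (Fin n)} {p : Node n} {c : Fin n}
    (h : (G.removeOut S).ParentOf p c) (hp : ∀ a, p = Sum.inl a → a ∈ S' → a ∈ S) :
    (G.removeOut S').ParentOf p c := by
  cases p with
  | inl a =>
    obtain ⟨h1, h2⟩ := dir_removeOut.1 h
    exact dir_removeOut.2 ⟨h1, fun h => h2 (hp a rfl h)⟩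
  | inr e =>
    obtain ⟨b, hb, he⟩ := h
    exact ⟨b, bi_removeOut.2 (bi_removeOut.1 hb), he⟩

theorem LatentReach.mono {G : ADMG n} {C S S' : Finset (Fin n)} (hS : S' ⊆ S) {u : Fin n}
    {p : Node n} (h : LatentReach (G.removeOut S) C u p) : LatentReach (G.removeOut S') C u p :=
  ReflTransGen.mono (fun _ _ h => ⟨h.1, h.2.mono
    (fun _ hc => parentOf_removeOut hc fun _ _ ha => hS ha)
    (fun _ hc => parentOf_removeOut hc fun _ _ ha => hS ha)⟩) _ _ h

/-- Removing edges out of a node only affects its role as a parent, and latent nodes are not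
affected. As the interior of the walk is latent or `u`, it suffices to compare `S` and `Z` at its
two ends. -/
theorem LatentReach.moralReach {G : ADMG n} {C S Z : Finset (Fin n)} {u w : Fin n}
    (h : LatentReach (G.removeOut S) C u (Sum.inl w)) (hu : u ∈ Z → u ∈ S) (hw : w ∉ Z) :
    ReflTransGen (MoralAdj (G.removeOut Z) C) (Sum.inl u) (Sum.inl w) := by
  have main : ∀ q, LatentReach (G.removeOut S) C u q → (∃ v ∈ Z, q = Sum.inl v) ∨
      ReflTransGen (MoralAdj (G.removeOut Z) C) (Sum.inl u) q := by
    intro q hq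
    induction hq with
    | refl => exact Or.inr ReflTransGen.refl
    | @tail p q _ hpq ih =>
      by_cases hqZ : ∃ v ∈ Z, q = Sum.inl v
      · exact Or.inl hqZ
      · have hp : ReflTransGen (MoralAdj (G.removeOut Z) C) (Sum.inl u) p := by
          rcases hpq.1 with rfl | hp
          · exact ReflTransGen.refl
          · rcases ih with ⟨v, -, rfl⟩ | ih
            · exact absurd hp (by simp)
            · exact ih
        refine Or.inr (hp.tail (hpq.2.mono (fun c hc => parentOf_removeOut hc ?_)
          fun c hc => parentOf_removeOut hc ?_))
        · rintro a rfl haZ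
          rcases hpq.1 with ha | ha
          · cases ha
            exact hu haZ
          · exact absurd ha (by simp)
        · rintro a rfl haZ
          exact absurd ⟨a, haZ, rfl⟩ hqZ
  rcases main _ h with ⟨v, hv, hwv⟩ | h
  · cases hwv
    exact absurd hv hw
  · exact h

theorem MoralAdj.mem_induce {G : ADMG n} {C S W : Finset (Fin n)} {p : Node n} {w : Fin n}
    (h : MoralAdj ((G.induce W).removeOut S) C p (Sum.inl w)) : w ∈ W := by
  rw [removeOut_induce] at h
  obtain ⟨-, -, c, ⟨h, hc⟩ | ⟨-, h⟩ | ⟨-, -, h⟩⟩ := h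
  · cases hc
    exact h.mem_induce
  · exact (dir_induce.1 h).2.1
  · exact (dir_induce.1 h).2.1

theorem LatentReach.mem_induce {G : ADMG n} {C S W : Finset (Fin n)} {u w : Fin n} (hwu : w ≠ u)
    (h : LatentReach ((G.induce W).removeOut S) C u (Sum.inl w)) : w ∈ W := by
  rcases ReflTransGen.cases_tail h with h | ⟨_, -, h⟩
  · exact absurd (Sum.inl.inj h) hwu
  · exact h.2.mem_induce

/-! ### The invariant of the search in `getDep`, its correctness and its cost. -/

section GetDep

variable (m : ℕ) (G : ADMG n) (X Y T R' W : Finset (Fin n))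

/-- The nodes with an incoming arrow. -/
def ADMG.heads : Finset (Fin n) :=
  Finset.univ.filter fun w => ∃ a, G.dir a w = true ∨ G.bi a w = true

/-- `sound` justifies the answer ⊥: visited nodes are reachable from every admissible Z. The other
fields justify the returned set: `expanded` makes the visited nodes closed under neighbours once the
queue is empty, and `heads` handles the collected nodes that were never queued. By `visited`, a
visited node of `R'` has already lost its outgoing edges. -/
structure DepInv (s : DepState n) : Prop where
  table : IsMoral m ((G.induce W).removeOut (T ∪ s.Z')) X s.M
  queue : ∀ u ∈ s.Q, u ∈ s.visited
  start : T ⊆ s.visited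
  subset : s.Z' ⊆ R'
  subset_induce : s.Z' ⊆ W
  visited : ∀ u ∈ s.visited, u ∈ R' → u ∈ T ∪ s.Z'
  expanded : ∀ u ∈ s.visited, u ∉ s.Q → u ∉ Y ∧
    ∀ w, LatentReach ((G.induce W).removeOut (T ∪ s.Z')) X u (Sum.inl w) → w ∈ s.visited
  heads : ∀ z ∈ s.Z', z ∉ s.visited → z ∉ G.heads
  sound : ∀ Z, T ⊆ Z → Z ⊆ R' → BackdoorSep G X Y Z → ∀ u ∈ s.visited, ∃ z ∈ Z,
    ReflTransGen (MoralAdj ((G.induce W).removeOut Z) X) (Sum.inl z) (Sum.inl u)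

variable {m G X Y T R' W}

theorem DepInv.not_backdoorSep {s : DepState n} (hs : DepInv m G X Y T R' W s)
    (hRX : Disjoint R' X) (hW : ∀ v, v ∈ W ↔ G.Anc (T ∪ X ∪ Y) v) {u : Fin n}
    (hu : u ∈ s.visited) (huY : u ∈ Y) :
    ¬ ∃ Z, T ⊆ Z ∧ Z ⊆ R' ∧ BackdoorSep G X Y Z := by
  rintro ⟨Z, hTZ, hZR, hZ⟩
  obtain ⟨z, hz, hzu⟩ := hs.sound Z hTZ hZR hZ u hu
  rw [removeOut_induce] at hzu
  refine not_moralReach_of_isSeparator hZ (fun c hc => ?_) hz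
    (Finset.disjoint_left.1 hRX (hZR hz)) huY hzu
  -- `W` was computed from `T` in the full graph. Since T ⊆ Z, its nodes are still ancestors of Z ∪
  -- Y ∪ X after the edges out of Z are removed.
  refine ADMG.Anc.removeOut (fun v hv => by simp [hv]) ?_
  obtain ⟨d, hd, hcd⟩ := (hW c).1 hc
  refine ⟨d, ?_, hcd⟩
  simp only [Finset.mem_union] at hd ⊢
  rcases hd with (hd | hd) | hd
  exacts [Or.inl (Or.inl (hTZ hd)), Or.inr hd, Or.inl (Or.inr hd)]

/-- With neither incoming nor remaining outgoing edges the node is isolated; this is why `getDep`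
need not queue it. -/
theorem not_moralAdj_of_not_heads {S : Finset (Fin n)} {a : Fin n} (ha : a ∈ S)
    (h : a ∉ G.heads) {q : Node n} :
    ¬ MoralAdj ((G.induce W).removeOut S) X (Sum.inl a) q := by
  simp only [ADMG.heads, Finset.mem_filter, Finset.mem_univ, true_and, not_exists, not_or] at h
  rintro ⟨-, -, c, ⟨h', -⟩ | ⟨hc, h'⟩ | ⟨-, h', -⟩⟩
  · exact (dir_removeOut.1 h').2 ha
  · cases hc
    cases q with
    | inl b => exact (h b).1 (dir_induce.1 (dir_removeOut.1 h').1).1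
    | inr e =>
      obtain ⟨b, hb, -⟩ := h'
      exact (h b).2 (bi_induce.1 (bi_removeOut.1 hb)).1
  · exact (dir_removeOut.1 h').2 ha

theorem DepInv.backdoorSep {s : DepState n} (hs : DepInv m G X Y T R' W s)
    (hRY : Disjoint R' Y) (hW : ∀ v, v ∈ W ↔ G.Anc (T ∪ X ∪ Y) v) (hQ : s.Q = []) :
    BackdoorSep G X Y (T ∪ s.Z') := by
  refine isSeparator_of_not_moralReach (W := W) ?_ ?_
  · rintro c ⟨d, hd, hcd⟩
    -- Adding `Z'` to `T` creates no new ancestors, because `Z'` was found inside `W`.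
    have hdW : G.Anc (T ∪ X ∪ Y) d := by
      simp only [Finset.mem_union] at hd
      rcases hd with ((hd | hd) | hd) | hd
      · exact ADMG.Anc.of_mem (by simp [hd])
      · exact (hW d).1 (hs.subset_induce hd)
      · exact ADMG.Anc.of_mem (by simp [hd])
      · exact ADMG.Anc.of_mem (by simp [hd])
    obtain ⟨x, hx, hdx⟩ := hdW
    exact (hW c).2 ⟨x, hx, (isDescendant_of_removeOut hcd).trans hdx⟩
  · intro a ha _ b hb hab
    rw [← removeOut_induce] at hab
    by_cases hav : a ∈ s.visited
    -- Cut at its observed nodes, a walk in the moral graph consists of pieces with latent interior,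
    -- and each piece leads from a visited node to a visited node.
    · have main : ∀ q, ReflTransGen (MoralAdj ((G.induce W).removeOut (T ∪ s.Z')) X) (Sum.inl a) q →
          ∃ u ∈ s.visited, LatentReach ((G.induce W).removeOut (T ∪ s.Z')) X u q := by
        intro q hq
        induction hq with
        | refl => exact ⟨a, hav, ReflTransGen.refl⟩
        | @tail p q _ hpq ih =>
          obtain ⟨u, hu, hup⟩ := ih
          cases p with
          | inl w =>
            exact ⟨w, (hs.expanded u hu (by simp [hQ])).2 w hup,
              ReflTransGen.single ⟨Or.inl rfl, hpq⟩⟩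
          | inr e => exact ⟨u, hu, hup.tail ⟨Or.inr rfl, hpq⟩⟩
      obtain ⟨u, hu, hub⟩ := main _ hab
      have hbv := (hs.expanded u hu (by simp [hQ])).2 b hub
      exact (hs.expanded b hbv (by simp [hQ])).1 hb
    · have haZ : a ∈ s.Z' := by
        rcases Finset.mem_union.1 ha with h | h
        · exact absurd (hs.start h) hav
        · exact h
      rcases ReflTransGen.cases_head hab with h | ⟨q, hq, -⟩
      · cases h
        exact Finset.disjoint_left.1 hRY (hs.subset haZ) hb
      · exact not_moralAdj_of_not_heads ha (hs.heads a haZ hav) hq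

/-- The state after a round of `GetDep` that expands `u`. -/
theorem DepInv.next {u : Fin n} {rest : List (Fin n)} {M M' : Node n → List (Node n)}
    {visited Z' A A' NR N : Finset (Fin n)} {L : List (Fin n)}
    (hs : DepInv m G X Y T R' W ⟨u :: rest, M, visited, Z'⟩) (huY : u ∉ Y)
    (hA : ∀ w, w ∈ A ↔ w ≠ u ∧
      LatentReach ((G.induce W).removeOut (T ∪ Z')) X u (Sum.inl w))
    (hNR : NR = (A ∩ R') \ visited)
    (hM' : IsMoral m ((G.induce W).removeOut (T ∪ Z' ∪ NR)) X M')
    (hA' : ∀ w, w ∈ A' ↔ w ≠ u ∧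
      LatentReach ((G.induce W).removeOut (T ∪ Z' ∪ NR)) X u (Sum.inl w))
    (hN : N = (A' \ visited) ∪ (NR ∩ G.heads)) (hL : L.toFinset = N) :
    DepInv m G X Y T R' W ⟨rest ++ L, M', visited ∪ N, Z' ∪ NR⟩ := by
  have hu : u ∈ visited := hs.queue u List.mem_cons_self
  have hmemL : ∀ w, w ∈ L ↔ w ∈ N := fun w => by rw [← hL, List.mem_toFinset]
  have hA'A : A' ⊆ A := fun w hw => (hA w).2 ⟨((hA' w).1 hw).1,
    ((hA' w).1 hw).2.mono Finset.subset_union_left⟩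
  have hNRmem : ∀ w, w ∈ NR ↔ (w ∈ A ∧ w ∈ R') ∧ w ∉ visited := fun w => by
    rw [hNR, Finset.mem_sdiff, Finset.mem_inter]
  have hNmem : ∀ w, w ∈ N ↔ (w ∈ A' ∧ w ∉ visited) ∨ (w ∈ NR ∧ w ∈ G.heads) := fun w => by
    rw [hN, Finset.mem_union, Finset.mem_sdiff, Finset.mem_inter]
  have hNA : ∀ w ∈ N, w ∈ A := by
    intro w hw
    rcases (hNmem w).1 hw with h | h
    · exact hA'A h.1
    · exact ((hNRmem w).1 h.1).1.1
  refine ⟨?_, ?_, ?_, ?_, ?_, ?_, ?_, ?_, ?_⟩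
  · rw [← Finset.union_assoc]
    exact hM'
  · intro w hw
    rcases List.mem_append.1 hw with hw | hw
    · exact Finset.mem_union_left _ (hs.queue w (List.mem_cons_of_mem _ hw))
    · exact Finset.mem_union_right _ ((hmemL w).1 hw)
  · exact hs.start.trans Finset.subset_union_left
  · exact Finset.union_subset hs.subset fun w hw => ((hNRmem w).1 hw).1.2
  · refine Finset.union_subset hs.subset_induce fun w hw => ?_
    obtain ⟨h1, h2⟩ := (hA w).1 ((hNRmem w).1 hw).1.1
    exact h2.mem_induce h1
  · intro w hw hwR
    simp only [Finset.mem_union] at hw ⊢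
    by_cases hwv : w ∈ visited
    · have := hs.visited w hwv hwR
      simp only [Finset.mem_union] at this
      tauto
    · have := (hNRmem w).2 ⟨⟨hNA w (by tauto), hwR⟩, hwv⟩
      tauto
  · intro v hv hvQ
    simp only [List.mem_append, hmemL, not_or] at hvQ
    have hvv : v ∈ visited := (Finset.mem_union.1 hv).resolve_right hvQ.2
    by_cases hvu : v = u
    · subst hvu
      refine ⟨huY, fun w hw => ?_⟩
      rw [← Finset.union_assoc] at hw
      by_cases hwv : w ∈ visited
      · exact Finset.mem_union_left _ hwv
      · refine Finset.mem_union_right _ ((hNmem w).2 (Or.inl ⟨(hA' w).2 ⟨?_, hw⟩, hwv⟩))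
        rintro rfl
        exact hwv hvv
    · obtain ⟨h1, h2⟩ := hs.expanded v hvv (by simp [hvu, hvQ.1])
      -- Nodes expanded earlier remain closed: removing further edges can only shrink their
      -- neighbourhoods.
      refine ⟨h1, fun w hw => Finset.mem_union_left _ (h2 w (hw.mono ?_))⟩
      exact Finset.union_subset_union_right Finset.subset_union_left
  · intro z hz hzv
    simp only [Finset.mem_union, not_or] at hz hzv
    rcases hz with hz | hz
    · exact hs.heads z hz hzv.1
    · exact fun h => hzv.2 ((hNmem z).2 (Or.inr ⟨hz, h⟩))
  · intro Z hTZ hZR hZ w hw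
    rcases Finset.mem_union.1 hw with hw | hw
    · exact hs.sound Z hTZ hZR hZ w hw
    -- If w lies in Z, the walk of length 0 will do. Otherwise a walk to u is prolonged to w; if u
    -- lies in Z ⊆ R', its outgoing edges were already removed, as `LatentReach.moralReach`
    -- requires.
    · by_cases hwZ : w ∈ Z
      · exact ⟨w, hwZ, ReflTransGen.refl⟩
      · obtain ⟨z, hz, hzu⟩ := hs.sound Z hTZ hZR hZ u hu
        exact ⟨z, hz, hzu.trans (((hA w).1 (hNA w hw)).2.moralReach
          (fun huZ => hs.visited u hu (hZR huZ)) hwZ)⟩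

theorem sat_getDepLoop (hG : G.numEdges ≤ m) (hTR : T ⊆ R') (hRX : Disjoint R' X)
    (hRY : Disjoint R' Y) (hW : ∀ v, v ∈ W ↔ G.Anc (T ∪ X ∪ Y) v) (s : DepState n)
    (hs : DepInv m G X Y T R' W s) :
    Sat (loop (getDepRound (G.induce W) X Y T R' G.heads) s)
      ((s.Q.length + (Finset.univ \ s.visited).card) * (55 * costUnit n m)) fun r =>
        r.isSome = true ↔ ∃ Z, T ⊆ Z ∧ Z ⊆ R' ∧ BackdoorSep G X Y Z := by
  have hU1 := one_le_costUnit n m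
  have hU2 := le_costUnit n m
  have hU3 := sq_le_costUnit n m
  refine sat_loop (DepInv m G X Y T R' W)
    (fun s => (s.Q.length + (Finset.univ \ s.visited).card) * (55 * costUnit n m)) ?_ s hs
  rintro ⟨Q, M, visited, Z'⟩ hs
  cases Q with
  | nil =>
    refine ⟨0, Sat.pure ⟨Nat.zero_le _, ?_⟩ 0⟩
    simp only [Option.isSome_some, true_iff]
    exact ⟨_, Finset.subset_union_left, Finset.union_subset hTR hs.subset,
      hs.backdoorSep hRY hW rfl⟩
  | cons u rest =>
    have hu : u ∈ visited := hs.queue u List.mem_cons_self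
    -- 55 = 1 + 3 · 15 + 7 + 2: one single step, two neighbour searches and one moralization, seven
    -- passes over the nodes and one stored graph. A round dequeues one node and queues exactly the
    -- newly visited ones, so queue length plus number of unvisited nodes drops by one.
    refine ⟨1 + (15 * costUnit n m + (n + (2 * n * n + (15 * costUnit n m + (15 * costUnit n m +
      (n + (n + (n + (n + (n + (n + 0))))))))))), Sat.charge_bind (Sat.ite (fun huY => ?_)
        fun huY => ?_)⟩
    · refine Sat.pure ⟨?_, ?_⟩ _
      · simp only [List.length_cons]
        refine le_trans ?_ (Nat.le_mul_of_pos_left _ (by omega))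
        rw [Nat.mul_assoc 2]
        omega
      · simpa using hs.not_backdoorSep hRX hW hu huY
    · refine Sat.bind (sat_getNeighbors hs.table u) fun A hA => ?_
      refine Sat.bind (sat_storeSet _) fun NR hNR => ?_
      refine Sat.bind (sat_storeGraph _) ?_
      rintro _ rfl
      refine Sat.bind (sat_moralize_unit ((numEdges_filterEdges_le _ _ _).trans
        ((numEdges_filterEdges_le _ _ _).trans hG)) X) fun M' hM' => ?_
      refine Sat.bind (sat_getNeighbors hM' u) fun A' hA' => ?_
      refine Sat.bind (sat_storeSet _) ?_
      rintro _ rfl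
      refine Sat.bind (sat_storeSet _) ?_
      rintro _ rfl
      refine Sat.bind (sat_storeSet _) fun N hN => ?_
      refine Sat.bind (sat_storeSet _) ?_
      rintro _ rfl
      refine Sat.bind (sat_listSet _) ?_
      rintro L ⟨hL, hLN⟩
      refine Sat.bind (sat_storeSet _) ?_
      rintro _ rfl
      have hlen : L.length = N.card := by rw [← hLN, List.toFinset_card_of_nodup hL]
      have hdisj : ∀ w ∈ N, w ∉ visited := by
        intro w hw
        rw [hN, Finset.mem_union, Finset.mem_sdiff, Finset.mem_inter, hNR, Finset.mem_sdiff] at hw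
        tauto
      have hcard : (Finset.univ \ visited).card =
          (Finset.univ \ (visited ∪ N)).card + N.card := by
        rw [← Finset.card_union_of_disjoint]
        · congr 1
          ext w
          have := hdisj w
          simp only [Finset.mem_sdiff, Finset.mem_univ, true_and, Finset.mem_union]
          tauto
        · rw [Finset.disjoint_left]
          intro w hw hwN
          simp [hwN] at hw
      have hφ : ((u :: rest).length + (Finset.univ \ visited).card) * (55 * costUnit n m) =
          ((rest ++ L).length + (Finset.univ \ (visited ∪ N)).card) * (55 * costUnit n m) +
            55 * costUnit n m := by
        rw [List.length_append, List.length_cons, hlen, hcard]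
        ring
      refine Sat.pure ⟨hs.next huY hA hNR hM' hA' hN hLN, ?_, ?_⟩ 0
      · simp only
        omega
      · simp only
        rw [hφ, Nat.mul_assoc 2]
        omega

theorem sat_getDep (hG : G.numEdges ≤ m) (hTR : T ⊆ R') (hRX : Disjoint R' X)
    (hRY : Disjoint R' Y) :
    Sat (getDep G X Y T R') ((n + 1) * (60 * costUnit n m)) fun r =>
        r.isSome = true ↔ ∃ Z, T ⊆ Z ∧ Z ⊆ R' ∧ BackdoorSep G X Y Z := by
  have hU1 := one_le_costUnit n m
  have hU2 := le_costUnit n m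
  have hU3 := sq_le_costUnit n m
  refine Sat.mono (k := n + ((4 * n + 2 * n * n) + (2 * n * n + (2 * n * n + (15 * costUnit n m +
    (2 * n * n + (n + (n + (n + (n + n * (55 * costUnit n m))))))))))) ?_ ?_ fun _ h => h
  · refine Sat.bind (sat_storeSet _) ?_
    rintro _ rfl
    refine Sat.bind (sat_ancestors G _) fun W hW => ?_
    refine Sat.bind (sat_storeGraph _) ?_
    rintro _ rfl
    refine Sat.bind (sat_storeGraph _) ?_
    rintro _ rfl
    refine Sat.bind (sat_moralize_unit ((numEdges_filterEdges_le _ _ _).trans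
      ((numEdges_filterEdges_le _ _ _).trans hG)) X) fun M hM => ?_
    refine Sat.charge_bind (Sat.bind (sat_storeSet _) ?_)
    rintro _ rfl
    refine Sat.bind (sat_listSet _) ?_
    rintro Q ⟨hQ, hQT⟩
    refine Sat.bind (sat_storeSet _) fun V hV => ?_
    rw [hV]
    refine Sat.bind (sat_storeSet _) ?_
    rintro _ rfl
    have hmemQ : ∀ w, w ∈ Q ↔ w ∈ T := fun w => by rw [← hQT, List.mem_toFinset]
    refine (sat_getDepLoop hG hTR hRX hRY hW _ ?_).mono ?_ fun _ h => h
    · refine ⟨show IsMoral m ((G.induce W).removeOut (T ∪ ∅)) X M by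
        rw [Finset.union_empty]; exact hM, fun u hu => (hmemQ u).1 hu, fun _ h => h, by simp, by simp,
        fun u hu _ => by simpa using hu, fun u hu hu' => absurd ((hmemQ u).2 hu) hu', by simp,
        fun Z hTZ _ _ u hu => ⟨u, hTZ hu, ReflTransGen.refl⟩⟩
    · refine Nat.mul_le_mul_right _ ?_
      -- Initially exactly the nodes of `T` are queued and visited, so the potential amounts to n
      -- rounds.
      simp only
      rw [← List.toFinset_card_of_nodup hQ, hQT, add_comm,
        Finset.card_sdiff_add_card_eq_card (Finset.subset_univ _), Finset.card_univ,
        Fintype.card_fin]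
  · have : (n + 1) * (60 * costUnit n m) = n * (55 * costUnit n m) + n * (5 * costUnit n m) +
        60 * costUnit n m := by ring
    rw [Nat.mul_assoc 2, this]
    omega

end GetDep

/-! ### Selecting candidates -/

/-- The outcome of a loop over `vs` that removes the nodes that are not good from `S` and fails
if one of them lies in `I`. -/
def FilterResult (good : Fin n → Prop) (I : Finset (Fin n)) (vs : List (Fin n))
    (S : Finset (Fin n)) : Option (Finset (Fin n)) → Prop
  | none => ∃ v ∈ vs, v ∈ I ∧ ¬ good v
  | some S' => (∀ v ∈ vs, v ∈ I → good v) ∧ ∀ w, w ∈ S' ↔ w ∈ S ∧ (w ∈ vs → good w)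

section FilterResult

variable {good : Fin n → Prop} {I S : Finset (Fin n)} {v : Fin n} {vs : List (Fin n)}
  {r : Option (Finset (Fin n))}

theorem FilterResult.cons_good (hv : good v) (h : FilterResult good I vs S r) :
    FilterResult good I (v :: vs) S r := by
  cases r with
  | none =>
    obtain ⟨w, hw, h⟩ := h
    exact ⟨w, List.mem_cons_of_mem _ hw, h⟩
  | some S' =>
    refine ⟨?_, fun w => (h.2 w).trans (and_congr_right fun _ => ?_)⟩
    · rintro w hw hwI
      rcases List.mem_cons.1 hw with rfl | hw
      exacts [hv, h.1 w hw hwI]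
    · rw [List.mem_cons]
      constructor
      · rintro h (rfl | hw)
        exacts [hv, h hw]
      · exact fun h hw => h (Or.inr hw)

theorem FilterResult.cons_bad (hv : ¬ good v) (hvI : v ∉ I)
    (h : FilterResult good I vs (S.erase v) r) : FilterResult good I (v :: vs) S r := by
  cases r with
  | none =>
    obtain ⟨w, hw, h⟩ := h
    exact ⟨w, List.mem_cons_of_mem _ hw, h⟩
  | some S' =>
    refine ⟨?_, fun w => (h.2 w).trans ?_⟩
    · rintro w hw hwI
      rcases List.mem_cons.1 hw with rfl | hw
      exacts [absurd hwI hvI, h.1 w hw hwI]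
    · rw [List.mem_cons, Finset.mem_erase]
      constructor
      · rintro ⟨⟨hwv, hwS⟩, h⟩
        exact ⟨hwS, fun hw => h (hw.resolve_left hwv)⟩
      · rintro ⟨hwS, h⟩
        refine ⟨⟨?_, hwS⟩, fun hw => h (Or.inr hw)⟩
        rintro rfl
        exact hv (h (Or.inl rfl))

theorem FilterResult.nil : FilterResult good I [] S (some S) := by
  simp [FilterResult]

theorem FilterResult.mem_iff {S' : Finset (Fin n)} (hvs : vs.toFinset = S)
    (h : FilterResult good I vs S (some S')) {w : Fin n} : w ∈ S' ↔ w ∈ S ∧ good w := by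
  rw [h.2 w, ← hvs, List.mem_toFinset]
  tauto

theorem FilterResult.subset {S' : Finset (Fin n)} (hvs : vs.toFinset = S) (hIS : I ⊆ S)
    (h : FilterResult good I vs S (some S')) : I ⊆ S' := by
  intro w hw
  have hwS := hIS hw
  refine (h.mem_iff hvs).2 ⟨hwS, h.1 w ?_ hw⟩
  rwa [← hvs, List.mem_toFinset] at hwS

end FilterResult

/-! ### The two loops that select candidates. -/

section Candidates

variable {m : ℕ} {G : ADMG n} {X Y I R : Finset (Fin n)}

theorem sat_getCand2ndLoop (hG : G.numEdges ≤ m) (vs : List (Fin n)) (S : Finset (Fin n)) :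
    Sat (getCand2ndLoop G X I vs S) (vs.length * (53 * costUnit n m))
      (FilterResult (fun v => G.IsSeparator X {v} ∅) I vs S) := by
  have hU1 := one_le_costUnit n m
  have hU2 := le_costUnit n m
  induction vs generalizing S with
  | nil => exact Sat.pure FilterResult.nil _
  | cons v vs ih =>
    refine Sat.mono (k := 1 + (n + (n + (50 * costUnit n m + vs.length * (53 * costUnit n m)))))
      (Sat.charge_bind (Sat.bind (sat_storeSet _) ?_)) ?_ fun _ h => h
    · rintro _ rfl
      refine Sat.bind (sat_storeSet _) ?_
      rintro _ rfl
      refine Sat.bind (sat_testSep hG _ _ _) fun sep hsep => ?_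
      refine Sat.ite (fun h => (ih S).mono le_rfl fun r hr => hr.cons_good (hsep.1 h))
        fun h => Sat.ite (fun hv => Sat.pure ?_ _) fun hv => ?_
      · exact ⟨v, List.mem_cons_self, hv, fun h' => h (hsep.2 h')⟩
      · exact (ih _).mono le_rfl fun r hr => hr.cons_bad (fun h' => h (hsep.2 h')) hv
    · rw [List.length_cons, Nat.add_mul]
      omega

theorem sat_getCand2ndFDC (hG : G.numEdges ≤ m) :
    Sat (getCand2ndFDC G X I R) ((n + 1) * (53 * costUnit n m)) fun r =>
      ∃ vs : List (Fin n), vs.toFinset = R ∧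
        FilterResult (fun v => (G.removeOut X).IsSeparator X {v} ∅) I vs R r := by
  have hU2 := le_costUnit n m
  have hU3 := sq_le_costUnit n m
  refine Sat.mono (k := 2 * n * n + (n + (n + n * (53 * costUnit n m)))) ?_ ?_ fun _ h => h
  · refine Sat.bind (sat_storeGraph _) ?_
    rintro _ rfl
    refine Sat.bind (sat_storeSet _) fun R' hR' => ?_
    rw [hR']
    refine Sat.bind (sat_listSet _) ?_
    rintro vs ⟨hvs, hvsR⟩
    refine (sat_getCand2ndLoop ((numEdges_filterEdges_le _ _ _).trans hG) vs R).mono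
      (Nat.mul_le_mul_right _ ?_) fun r hr => ⟨vs, hvsR, hr⟩
    simpa using hvs.length_le_card
  · rw [Nat.mul_assoc 2, Nat.add_mul]
    omega

/-- The node belongs to a subset of `R` that satisfies the third front-door condition. -/
def IsThirdCand (G : ADMG n) (X Y R : Finset (Fin n)) (v : Fin n) : Prop :=
  ∃ Z, {v} ⊆ Z ∧ Z ⊆ R ∧ BackdoorSep G X Y Z

/-- Every call of `getDep` refers to the fixed `R` and not to the shrinking `S`, so the criterion
for a node does not depend on the order of the loop. -/
theorem sat_getCand3rdLoop (hG : G.numEdges ≤ m) (hRX : Disjoint R X) (hRY : Disjoint R Y)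
    (vs : List (Fin n)) (hvs : ∀ v ∈ vs, v ∈ R) (S : Finset (Fin n)) :
    Sat (getCand3rdLoop G X Y I R vs S) (vs.length * ((n + 1) * (62 * costUnit n m)))
      (FilterResult (IsThirdCand G X Y R) I vs S) := by
  have hU1 := one_le_costUnit n m
  have hU2 := le_costUnit n m
  induction vs generalizing S with
  | nil => exact Sat.pure FilterResult.nil _
  | cons v vs ih =>
    have ih := fun S => ih (fun w hw => hvs w (List.mem_cons_of_mem _ hw)) S
    refine Sat.mono (k := 1 + (n + ((n + 1) * (60 * costUnit n m) +
      vs.length * ((n + 1) * (62 * costUnit n m)))))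
      (Sat.charge_bind (Sat.bind (sat_storeSet _) ?_)) ?_ fun _ h => h
    · rintro _ rfl
      refine Sat.bind (sat_getDep hG (Finset.singleton_subset_iff.2 (hvs v List.mem_cons_self))
        hRX hRY) fun dep hdep => ?_
      refine Sat.ite (fun h => (ih S).mono le_rfl fun r hr => hr.cons_good (hdep.1 h))
        fun h => Sat.ite (fun hv => Sat.pure ?_ _) fun hv => ?_
      · exact ⟨v, List.mem_cons_self, hv, fun h' => h (hdep.2 h')⟩
      · exact (ih _).mono le_rfl fun r hr => hr.cons_bad (fun h' => h (hdep.2 h')) hv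
    · have : (vs.length + 1) * ((n + 1) * (62 * costUnit n m)) =
          vs.length * ((n + 1) * (62 * costUnit n m)) + (n + 1) * (60 * costUnit n m) +
          (n * (2 * costUnit n m) + 2 * costUnit n m) := by ring
      rw [List.length_cons, this]
      omega

theorem sat_getCand3rdFDC (hG : G.numEdges ≤ m) (hRX : Disjoint R X) (hRY : Disjoint R Y) :
    Sat (getCand3rdFDC G X Y I R) ((n + 1) * ((n + 1) * (62 * costUnit n m))) fun r =>
      ∃ vs : List (Fin n), vs.toFinset = R ∧ FilterResult (IsThirdCand G X Y R) I vs R r := by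
  have hU2 := le_costUnit n m
  refine Sat.mono (k := n + (n + n * ((n + 1) * (62 * costUnit n m)))) ?_ ?_ fun _ h => h
  · refine Sat.bind (sat_storeSet _) fun R' hR' => ?_
    rw [hR']
    refine Sat.bind (sat_listSet _) ?_
    rintro vs ⟨hvs, hvsR⟩
    refine (sat_getCand3rdLoop hG hRX hRY vs
      (fun v hv => by rwa [← hvsR, List.mem_toFinset]) R).mono
      (Nat.mul_le_mul_right _ ?_) fun r hr => ⟨vs, hvsR, hr⟩
    simpa using hvs.length_le_card
  · have : (n + 1) * ((n + 1) * (62 * costUnit n m)) = n * ((n + 1) * (62 * costUnit n m)) +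
        (n * (62 * costUnit n m) + 62 * costUnit n m) := by ring
    rw [this]
    omega

end Candidates

/-! ### The causal path graph -/

/-- The graph of the proper causal paths from `X` to `Y`. -/
def causalPathGraph (G : ADMG n) (X Y D A : Finset (Fin n)) : ADMG n :=
  (((G.induce (X ∪ Y ∪ ((D \ X) ∩ A))).removeIn X).removeOut Y).dropBi

theorem sat_getCausalPathGraph (m : ℕ) (G : ADMG n) (X Y : Finset (Fin n)) :
    Sat (getCausalPathGraph G X Y) (22 * costUnit n m) fun H =>
      ∃ D A : Finset (Fin n), (∀ v, v ∈ D ↔ ∃ x ∈ X, (G.removeIn X).IsDescendant x v) ∧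
        (∀ v, v ∈ A ↔ (G.removeOut X).Anc Y v) ∧ H = causalPathGraph G X Y D A := by
  have hU2 := le_costUnit n m
  have hU3 := sq_le_costUnit n m
  refine Sat.mono (k := 2 * n * n + ((4 * n + 2 * n * n) + (2 * n * n + ((4 * n + 2 * n * n) +
    (n + (n + (2 * n * n + 2 * n * n))))))) ?_ ?_ fun _ h => h
  · refine Sat.bind (sat_storeGraph _) ?_
    rintro _ rfl
    refine Sat.bind (sat_descendants _ _) fun D hD => ?_
    refine Sat.bind (sat_storeGraph _) ?_
    rintro _ rfl
    refine Sat.bind (sat_ancestors _ _) fun A hA => ?_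
    refine Sat.bind (sat_storeSet _) ?_
    rintro _ rfl
    refine Sat.bind (sat_storeSet _) ?_
    rintro _ rfl
    refine Sat.bind (sat_storeGraph _) ?_
    rintro _ rfl
    refine (sat_storeGraph _).mono le_rfl ?_
    rintro _ rfl
    exact ⟨D, A, hD, hA, rfl⟩
  · rw [Nat.mul_assoc 2]
    omega

theorem numEdges_causalPathGraph_le (G : ADMG n) (X Y D A : Finset (Fin n)) :
    (causalPathGraph G X Y D A).numEdges ≤ G.numEdges :=
  (numEdges_filterEdges_le _ _ _).trans <| (numEdges_filterEdges_le _ _ _).trans <|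
    (numEdges_filterEdges_le _ _ _).trans (numEdges_filterEdges_le _ _ _)

/-- A step along an edge out of a node that is not in `Z`. -/
def StepAvoid (G : ADMG n) (Z : Finset (Fin n)) (a b : Fin n) : Prop :=
  G.dir a b = true ∧ a ∉ Z

/-! ### Interception of directed paths as separation in the causal path graph. -/

section Causal

variable {G : ADMG n} {X Y Z D A : Finset (Fin n)}

theorem dir_causalPathGraph {a b : Fin n} : (causalPathGraph G X Y D A).dir a b = true ↔
    G.dir a b = true ∧ (a ∈ X ∪ Y ∪ ((D \ X) ∩ A) ∧ b ∈ X ∪ Y ∪ ((D \ X) ∩ A)) ∧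
      b ∉ X ∧ a ∉ Y := by
  rw [causalPathGraph, dir_dropBi, dir_removeOut, dir_removeIn, dir_induce, and_assoc, and_assoc]

/-- Acyclicity turns directed walks into paths, so the condition becomes one about reachability. -/
theorem intercepts_iff : (∀ len p e, G.IsPath len p e → (∀ i, i < len → e i = EdgeKind.fwd) →
    p 0 ∈ X → p len ∈ Y → ∃ i, i ≤ len ∧ p i ∈ Z) ↔
    ∀ x ∈ X, ∀ y ∈ Y, y ∉ Z → ¬ ReflTransGen (StepAvoid G Z) x y := by
  constructor
  · intro h x hx y hy hyZ hxy
    have : ∃ (len : ℕ) (p : ℕ → Fin n), p 0 = x ∧ p len = y ∧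
        (∀ i, i < len → G.dir (p i) (p (i + 1)) = true) ∧ ∀ i, i ≤ len → p i ∉ Z := by
      clear hx
      induction hxy using ReflTransGen.head_induction_on with
      | refl => exact ⟨0, fun _ => y, rfl, rfl, fun i hi => absurd hi (Nat.not_lt_zero _),
          fun _ _ => hyZ⟩
      | @head a b hab _ ih =>
        obtain ⟨len, p, rfl, hpl, hdir, hZ⟩ := ih
        refine ⟨len + 1, fun i => if i = 0 then a else p (i - 1), rfl, by simpa using hpl, ?_, ?_⟩
        · intro i hi
          cases i with
          | zero => simpa using hab.1
          | succ i => simpa using hdir i (by omega)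
        · intro i hi
          cases i with
          | zero => simpa using hab.2
          | succ i => simpa using hZ i (by omega)
    obtain ⟨len, p, rfl, rfl, hdir, hZ⟩ := this
    have hlt : ∀ d i, i + (d + 1) ≤ len →
        TransGen (fun a b => G.dir a b = true) (p i) (p (i + (d + 1))) := by
      intro d i
      induction d with
      | zero => exact fun hi => TransGen.single (hdir i hi)
      | succ d ih => exact fun hi => (ih (by omega)).tail (hdir _ (by omega))
    have hne : ∀ i j, i < j → j ≤ len → p i ≠ p j := by
      intro i j hij hj h
      have := hlt (j - i - 1) i (by omega)
      rw [show i + (j - i - 1 + 1) = j by omega, h] at this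
      exact G.acyclic _ this
    obtain ⟨i, hi, hiZ⟩ := h len p (fun _ => .fwd) ⟨hdir, fun i j hi hj hij => by
      rcases lt_trichotomy i j with h | h | h
      · exact absurd hij (hne i j h hj)
      · exact h
      · exact absurd hij.symm (hne j i h hi)⟩ (fun _ _ => rfl) hx hy
    exact hZ i hi hiZ
  · intro h len p e hp he h0 hl
    by_contra hZ
    push Not at hZ
    refine h _ h0 _ hl (hZ len le_rfl) ?_
    have : ∀ i, i ≤ len → ReflTransGen (StepAvoid G Z) (p 0) (p i) := by
      intro i
      induction i with
      | zero => exact fun _ => ReflTransGen.refl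
      | succ i ih =>
        intro hi
        have hdir := hp.edge i hi
        rw [he i hi] at hdir
        exact (ih (by omega)).tail ⟨hdir, hZ i (by omega)⟩
    exact this len le_rfl

/-- Each directed path from `X` to `Y` contains a proper one. -/
theorem exists_proper_causal_path {x y : Fin n} (hx : x ∈ X) (hy : y ∈ Y) (hyZ : y ∉ Z)
    (hxy : ReflTransGen (StepAvoid G Z) x y) : ∃ x' ∈ X, ∃ y' ∈ Y, y' ∉ Z ∧
      ReflTransGen (fun a b => StepAvoid G Z a b ∧ b ∉ X ∧ a ∉ Y) x' y' := by
  -- The walk is cut at its last node in `X`, and the rest then at its first node in `Y`.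
  have h1 : ∃ x' ∈ X, ReflTransGen (fun a b => StepAvoid G Z a b ∧ b ∉ X) x' y := by
    have : (∃ x' ∈ X, ReflTransGen (fun a b => StepAvoid G Z a b ∧ b ∉ X) x' y) ∨
        ReflTransGen (fun a b => StepAvoid G Z a b ∧ b ∉ X) x y := by
      clear hx
      induction hxy using ReflTransGen.head_induction_on with
      | refl => exact Or.inr ReflTransGen.refl
      | @head a b hab _ ih =>
        rcases ih with h | h
        · exact Or.inl h
        · by_cases hb : b ∈ X
          · exact Or.inl ⟨b, hb, h⟩
          · exact Or.inr (h.head ⟨hab, hb⟩)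
    exact this.elim id fun h => ⟨x, hx, h⟩
  obtain ⟨x', hx', h⟩ := h1
  refine ⟨x', hx', ?_⟩
  have : (∃ y' ∈ Y, y' ∉ Z ∧
      ReflTransGen (fun a b => StepAvoid G Z a b ∧ b ∉ X ∧ a ∉ Y) x' y') ∨
      ReflTransGen (fun a b => StepAvoid G Z a b ∧ b ∉ X ∧ a ∉ Y) x' y := by
    clear hy hyZ hxy
    induction h with
    | refl => exact Or.inr ReflTransGen.refl
    | @tail b c _ hbc ih =>
      rcases ih with h | h
      · exact Or.inl h
      · by_cases hb : b ∈ Y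
        · exact Or.inl ⟨b, hb, hbc.1.2, h⟩
        · exact Or.inr (h.tail ⟨hbc.1, hbc.2, hb⟩)
  exact this.elim id fun h => ⟨y, hy, hyZ, h⟩

/-- A proper directed path survives in the causal path graph: outside `X` its nodes are descendants
of `X` and ancestors of `Y` in the required graphs. Being directed and avoiding `Z`, it is active.
-/
theorem intercepts_of_isSeparator (hD : ∀ v, v ∈ D ↔ ∃ x ∈ X, (G.removeIn X).IsDescendant x v)
    (hA : ∀ v, v ∈ A ↔ (G.removeOut X).Anc Y v)
    (hsep : (causalPathGraph G X Y D A).IsSeparator X Y Z) :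
    ∀ x ∈ X, ∀ y ∈ Y, y ∉ Z → ¬ ReflTransGen (StepAvoid G Z) x y := by
  intro x hx y hy hyZ hxy
  obtain ⟨x', hx', y', hy', hyZ', h⟩ := exists_proper_causal_path hx hy hyZ hxy
  have hanc : ∀ b, ReflTransGen (fun a b => StepAvoid G Z a b ∧ b ∉ X ∧ a ∉ Y) b y' → b ∉ X →
      b ∈ A := by
    intro b hb
    induction hb using ReflTransGen.head_induction_on with
    | refl => exact fun _ => (hA _).2 (ADMG.Anc.of_mem hy')
    | head hab _ ih =>
      intro ha
      exact (hA _).2 (((hA _).1 (ih hab.2.1)).of_dir (dir_removeOut.2 ⟨hab.1.1, ha⟩))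
  have hdesc : ∀ b, ReflTransGen (fun a b => StepAvoid G Z a b ∧ b ∉ X ∧ a ∉ Y) x' b →
      b ∈ D := by
    intro b hb
    refine (hD b).2 ⟨x', hx', ?_⟩
    exact ReflTransGen.mono (fun _ _ h => dir_removeIn.2 ⟨h.1.1, h.2.1⟩) _ _ hb
  have hpath : ∀ c, ReflTransGen (fun a b => StepAvoid G Z a b ∧ b ∉ X ∧ a ∉ Y) c y' →
      ReflTransGen (fun a b => StepAvoid G Z a b ∧ b ∉ X ∧ a ∉ Y) x' c →
      ReflTransGen (fun a b => (causalPathGraph G X Y D A).dir a b = true ∧ a ∉ Z) c y' := by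
    intro c hc
    induction hc using ReflTransGen.head_induction_on with
    | refl => exact fun _ => ReflTransGen.refl
    | @head a b hab hb ih =>
      intro ha
      refine (ih (ha.tail hab)).head ⟨dir_causalPathGraph.2 ⟨hab.1.1, ⟨?_, ?_⟩, hab.2⟩, hab.1.2⟩
      · by_cases haX : a ∈ X
        · simp [haX]
        · simp [haX, hdesc a ha, hanc a (hb.head hab) haX]
      · simp [hab.2.1, hdesc b (ha.tail hab), hanc b hb hab.2.1]
  obtain ⟨h', hconn⟩ := (Conn.start hx').forward (hpath x' h ReflTransGen.refl)
  exact hyZ' (hconn.mem_of_isSeparator hsep hy')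

/-- Let d' be the first node of `Z` on the way from c to d. Then d' ← … ← f → … → y uses no edge out
of `Z`, has no collider, and avoids `X` because the causal path graph has no edges into `X`. It is
thus a back-door walk from `Z` to `Y` that `X` does not block. -/
theorem false_of_fork (hXY : Disjoint X Y) (hZ : BackdoorSep G X Y Z) {f c d y : Fin n}
    (hf : f ∉ X) (hy : y ∈ Y)
    (hfy : ReflTransGen (StepAvoid (causalPathGraph G X Y D A) Z) f y)
    (hfc : TransGen (StepAvoid (causalPathGraph G X Y D A) Z) f c)
    (hcd : (causalPathGraph G X Y D A).IsDescendant c d) (hd : d ∈ Z) : False := by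
  have hfirst : ∃ d' ∈ Z, ReflTransGen (StepAvoid (causalPathGraph G X Y D A) Z) c d' := by
    clear hfc
    induction hcd using ReflTransGen.head_induction_on with
    | refl => exact ⟨d, hd, ReflTransGen.refl⟩
    | @head a b hab _ ih =>
      by_cases ha : a ∈ Z
      · exact ⟨a, ha, ReflTransGen.refl⟩
      · obtain ⟨d', hd', hbd⟩ := ih
        exact ⟨d', hd', hbd.head ⟨hab, ha⟩⟩
  obtain ⟨d', hd', hcd'⟩ := hfirst
  have hfd := hfc.trans_left hcd'
  have hd'X : d' ∉ X := by
    obtain ⟨b, -, hb⟩ := TransGen.tail'_iff.1 hfd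
    exact (dir_causalPathGraph.1 hb.1).2.2.1
  have lift : ∀ a b, ReflTransGen (StepAvoid (causalPathGraph G X Y D A) Z) a b → a ∉ X →
      ReflTransGen (fun a b => (G.removeOut Z).dir a b = true ∧ a ∉ X) a b := by
    intro a b hab
    induction hab using ReflTransGen.head_induction_on with
    | refl => exact fun _ => ReflTransGen.refl
    | head hab _ ih =>
      intro ha
      have := dir_causalPathGraph.1 hab.1
      exact (ih this.2.2.1).head ⟨dir_removeOut.2 ⟨this.1, hab.2⟩, ha⟩
  have hstart : ConnHead (G.removeOut Z) Z X d' :=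
    ⟨False, Conn.start hd', fun h => h.elim, fun _ => hd'X⟩
  obtain ⟨h, hconn, -, -⟩ := hstart.backward (lift f d' hfd.to_reflTransGen hf)
  obtain ⟨h', hconn'⟩ := hconn.forward (lift f y hfy hf)
  exact Finset.disjoint_right.1 hXY hy (hconn'.mem_of_isSeparator hZ hy)

theorem isSeparator_of_intercepts (hXY : Disjoint X Y) (hZ : BackdoorSep G X Y Z)
    (hint : ∀ x ∈ X, ∀ y ∈ Y, y ∉ Z → ¬ ReflTransGen (StepAvoid G Z) x y) :
    (causalPathGraph G X Y D A).IsSeparator X Y Z := by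
  intro len p e hp h0 hl
  by_contra hblock
  obtain ⟨hact, hlZ⟩ := not_blocked_iff.1 hblock
  set H := causalPathGraph G X Y D A with hH
  have hcausal : ∀ f ∈ X, ∀ y ∈ Y, y ∉ Z → ¬ ReflTransGen (StepAvoid H Z) f y :=
    fun f hf y hy hyZ h => hint f hf y hy hyZ
      (ReflTransGen.mono (fun _ _ h => ⟨(dir_causalPathGraph.1 h.1).1, h.2⟩) _ _ h)
  -- The path is read from its end. Either its i-th node leads to `Y` by directed edges avoiding
  -- `Z`, or its next edge points backward and some fork f leads both to `Y` and to this node. A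
  -- forward edge in front of the second case makes a collider, which `false_of_fork` excludes. At
  -- index 0 the first case contradicts interception, the second the absence of edges into `X`.
  have main : ∀ d i, i + d = len →
      (∃ y ∈ Y, y ∉ Z ∧ ReflTransGen (StepAvoid H Z) (p i) y) ∨
      (i < len ∧ e i = .bwd ∧ ∃ f, f ∉ X ∧
        (∃ y ∈ Y, y ∉ Z ∧ ReflTransGen (StepAvoid H Z) f y) ∧
        TransGen (StepAvoid H Z) f (p i)) := by
    intro d
    induction d with
    | zero =>
      rintro i rfl
      exact Or.inl ⟨p i, hl, hlZ, ReflTransGen.refl⟩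
    | succ d ih =>
      intro i hid
      have hi : i < len := by omega
      have hedge := hp.edge i hi
      cases hk : e i with
      | fwd =>
        rw [hk] at hedge
        have hiZ : p i ∉ Z := (hact i hi).2 fun hc => by
          have := hc.2.2
          rw [hk] at this
          exact this
        rcases ih (i + 1) (by omega) with ⟨y, hy, hyZ, h⟩ | ⟨hlt, hbwd, f, hf, ⟨y, hy, hyZ, hfy⟩, h⟩
        · exact Or.inl ⟨y, hy, hyZ, h.head ⟨hedge, hiZ⟩⟩
        · have hc : HeadToHead e (i + 1) := by
            refine ⟨Nat.succ_pos _, ?_, ?_⟩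
            · rw [Nat.add_sub_cancel, hk]; trivial
            · rw [hbwd]; trivial
          obtain ⟨d, hd, hcd⟩ := (hact (i + 1) hlt).1 hc
          exact (false_of_fork hXY hZ hf hy hfy h hcd hd).elim
      | bwd =>
        rw [hk] at hedge
        refine Or.inr ⟨hi, rfl, ?_⟩
        have hiZ : p (i + 1) ∉ Z := by
          rcases Nat.lt_or_eq_of_le (Nat.succ_le_of_lt hi) with hlt | heq
          · refine (hact (i + 1) hlt).2 fun hc => ?_
            have := hc.2.1
            rw [Nat.add_sub_cancel, hk] at this
            exact this
          · rw [← heq] at hlZ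
            exact hlZ
        rcases ih (i + 1) (by omega) with ⟨y, hy, hyZ, h⟩ | ⟨-, -, f, hf, hfy, h⟩
        · exact ⟨p (i + 1), fun hX => hcausal _ hX y hy hyZ h, ⟨y, hy, hyZ, h⟩,
            TransGen.single ⟨hedge, hiZ⟩⟩
        · exact ⟨f, hf, hfy, h.tail ⟨hedge, hiZ⟩⟩
      | both =>
        rw [hk] at hedge
        exact absurd hedge (by simp [ADMG.HasEdge, hH, causalPathGraph, bi_dropBi])
  rcases main len 0 (Nat.zero_add _) with ⟨y, hy, hyZ, h⟩ | ⟨-, -, f, -, -, h⟩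
  · exact hcausal _ h0 y hy hyZ h
  · obtain ⟨b, -, hb⟩ := TransGen.tail'_iff.1 h
    exact (dir_causalPathGraph.1 hb.1).2.2.1 h0

end Causal

/-! ### Correctness and running time -/

section FindFDSet

variable {G : ADMG n} {X Y I R : Finset (Fin n)}

theorem isSeparator_iff_singleton {A B C : Finset (Fin n)} :
    G.IsSeparator A B C ↔ ∀ b ∈ B, G.IsSeparator A {b} C := by
  constructor
  · intro h b hb len p e hp h0 hl
    rw [Finset.mem_singleton] at hl
    exact h len p e hp h0 (hl ▸ hb)
  · exact fun h len p e hp h0 hl => h _ hl len p e hp h0 (Finset.mem_singleton_self _)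

/-- A path from v in the graph without edges out of `S` also exists if only the edges out of some Z
⊆ S containing v are removed. It is blocked there, and remains blocked because a collider has fewer
descendants in the smaller graph. -/
theorem backdoorSep_of_cover {S : Finset (Fin n)}
    (h : ∀ v ∈ S, ∃ Z, v ∈ Z ∧ Z ⊆ S ∧ BackdoorSep G X Y Z) : BackdoorSep G X Y S := by
  intro len p e hp h0 hl
  obtain ⟨Z, hvZ, hZS, hZ⟩ := h _ h0
  have hdir : ∀ a b, (G.removeOut S).dir a b = true → (G.removeOut Z).dir a b = true :=
    fun a b h => dir_removeOut.2 ((dir_removeOut.1 h).imp_right fun h h' => h (hZS h'))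
  have hp' : (G.removeOut Z).IsPath len p e := by
    refine ⟨fun i hi => ?_, hp.inj⟩
    have := hp.edge i hi
    cases hk : e i with
    | fwd => rw [hk] at this; exact hdir _ _ this
    | bwd => rw [hk] at this; exact hdir _ _ this
    | both => rw [hk] at this; exact bi_removeOut.2 (bi_removeOut.1 this)
  obtain ⟨i, hi, h⟩ := hZ len p e hp' hvZ hl
  exact ⟨i, hi, h.imp_left fun h => ⟨h.1, fun d hd hdesc =>
    h.2 d hd (ReflTransGen.mono hdir _ _ hdesc)⟩⟩

theorem sat_findFDSet (hXY : Disjoint X Y) (hIR : I ⊆ R) (hRY : Disjoint R Y) :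
    Sat (findFDSet G X Y I R) ((n + 1) * (n + 1) * (187 * costUnit n G.numEdges)) fun out =>
      (∀ Z, out = some Z → I ⊆ Z ∧ Z ⊆ R ∧ FrontDoorCriterion G X Y Z) ∧
      (out = none → ¬ ∃ Z, I ⊆ Z ∧ Z ⊆ R ∧ FrontDoorCriterion G X Y Z) := by
  set U := costUnit n G.numEdges with hU
  have hnone : ∀ k, (¬ ∃ Z, I ⊆ Z ∧ Z ⊆ R ∧ FrontDoorCriterion G X Y Z) →
      Sat (pure none) k fun out : Option (Finset (Fin n)) =>
        (∀ Z, out = some Z → I ⊆ Z ∧ Z ⊆ R ∧ FrontDoorCriterion G X Y Z) ∧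
        (out = none → ¬ ∃ Z, I ⊆ Z ∧ Z ⊆ R ∧ FrontDoorCriterion G X Y Z) :=
    fun k h => Sat.pure ⟨fun Z hZ => by simp at hZ, fun _ => h⟩ k
  -- 187 = 53 + 62 + 22 + 50, each summand being multiplied by at most (n + 1)².
  refine Sat.mono (k := (n + 1) * (53 * U) + ((n + 1) * ((n + 1) * (62 * U)) +
    (22 * U + (50 * U + 0)))) ?_ ?_ fun _ h => h
  · refine Sat.bind (sat_getCand2ndFDC le_rfl) ?_
    rintro (_ | R') ⟨vs, hvs, hr⟩
    · refine hnone _ ?_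
      rintro ⟨Z, hIZ, -, hZ⟩
      obtain ⟨v, -, hvI, hv⟩ := hr
      exact hv (isSeparator_iff_singleton.1 hZ.no_backdoor v (hIZ hvI))
    have hR' : ∀ w, w ∈ R' ↔ w ∈ R ∧ (G.removeOut X).IsSeparator X {w} ∅ := fun w =>
      hr.mem_iff hvs
    have hIR' := hr.subset hvs hIR
    have hR'R : R' ⊆ R := fun w hw => ((hR' w).1 hw).1
    have hR'Y : Disjoint R' Y := Finset.disjoint_of_subset_left hR'R hRY
    -- A node of `X` would be a path of length 0 that the empty set does not block.
    have hR'X : Disjoint R' X := Finset.disjoint_left.2 fun w hw hwX =>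
      absurd ((Conn.start hwX).mem_of_isSeparator ((hR' w).1 hw).2 (Finset.mem_singleton_self w))
        (Finset.notMem_empty w)
    have hsub : ∀ Z, Z ⊆ R → FrontDoorCriterion G X Y Z → Z ⊆ R' := fun Z hZR hZ w hw =>
      (hR' w).2 ⟨hZR hw, isSeparator_iff_singleton.1 hZ.no_backdoor w hw⟩
    clear hr hvs
    refine Sat.bind (sat_getCand3rdFDC le_rfl hR'X hR'Y) ?_
    rintro (_ | R'') ⟨vs', hvs, hr⟩
    · refine hnone _ ?_
      rintro ⟨Z, hIZ, hZR, hZ⟩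
      obtain ⟨v, -, hvI, hv⟩ := hr
      exact hv ⟨Z, Finset.singleton_subset_iff.2 (hIZ hvI), hsub Z hZR hZ, hZ.backdoor_blocked⟩
    have hR'' : ∀ w, w ∈ R'' ↔ w ∈ R' ∧ IsThirdCand G X Y R' w := fun w => hr.mem_iff hvs
    have hIR'' := hr.subset hvs hIR'
    have hR''R' : R'' ⊆ R' := fun w hw => ((hR'' w).1 hw).1
    have hsub' : ∀ Z, Z ⊆ R' → BackdoorSep G X Y Z → Z ⊆ R'' := fun Z hZR hZ w hw =>
      (hR'' w).2 ⟨hZR hw, Z, Finset.singleton_subset_iff.2 hw, hZR, hZ⟩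
    have hback : BackdoorSep G X Y R'' := backdoorSep_of_cover fun v hv => by
      obtain ⟨Z, hvZ, hZR, hZ⟩ := ((hR'' v).1 hv).2
      exact ⟨Z, Finset.singleton_subset_iff.1 hvZ, hsub' Z hZR hZ, hZ⟩
    refine Sat.bind (sat_getCausalPathGraph G.numEdges G X Y) ?_
    rintro _ ⟨D, A, hD, hA, rfl⟩
    refine Sat.bind (sat_testSep (numEdges_causalPathGraph_le G X Y D A) _ _ _) fun sep hsep => ?_
    refine Sat.ite (fun h => Sat.pure ?_ _) fun h => hnone _ ?_
    · refine ⟨fun Z hZ => ?_, by simp⟩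
      obtain rfl := Option.some.inj hZ
      refine ⟨hIR'', hR''R'.trans hR'R, ?_, ?_, hback⟩
      · exact intercepts_iff.2 (intercepts_of_isSeparator hD hA (hsep.1 h))
      · exact isSeparator_iff_singleton.2 fun w hw => ((hR' w).1 (hR''R' hw)).2
    · rintro ⟨Z, -, hZR, hZ⟩
      refine h (hsep.2 (isSeparator_of_intercepts hXY hback (intercepts_iff.1 ?_)))
      intro len p e hp he h0 hl
      obtain ⟨i, hi, hiZ⟩ := hZ.intercepts len p e hp he h0 hl
      exact ⟨i, hi, hsub' Z (hsub Z hZR hZ) hZ.backdoor_blocked hiZ⟩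
  · nlinarith [Nat.zero_le (n * U), Nat.zero_le (n * n * U)]

end FindFDSet

end FrontDoor

/-- With `n` nodes and `m` edges, `findFDSet` halts after some number `t` of steps with an answer
`out`, where `t ≤ C * n ^ 3 * (n + m)` for an absolute constant `C` (for `n = 0` only this bound is
void). -/
theorem mainTheorem1 :
    ∃ C : ℕ, ∀ (n : ℕ) (G : FrontDoor.ADMG n) (X Y I R : Finset (Fin n)),
      Disjoint X Y → I ⊆ R → Disjoint R Y →
      ∃ (out : Option (Finset (Fin n))) (t : ℕ),
        (FrontDoor.findFDSet G X Y I R).run 0 = some (out, t) ∧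
        (0 < n → t ≤ C * (n ^ 3 * (n + G.numEdges))) ∧
        (∀ Z, out = some Z → I ⊆ Z ∧ Z ⊆ R ∧ FrontDoor.FrontDoorCriterion G X Y Z) ∧
        (out = none ↔ ¬ ∃ Z, I ⊆ Z ∧ Z ⊆ R ∧ FrontDoor.FrontDoorCriterion G X Y Z) := by
  -- 1496 = 187 · 4 · 2: for n ≥ 1, (n + 1)² ≤ 4n² and the cost unit is at most 2n(n + m).
  refine ⟨1496, fun n G X Y I R hXY hIR hRY => ?_⟩
  obtain ⟨out, t, ht, ⟨h1, h2⟩, hrun⟩ := FrontDoor.sat_findFDSet (G := G) hXY hIR hRY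
  refine ⟨out, t, (hrun 0).trans (by rw [Nat.zero_add]), fun hn => ht.trans ?_, h1, h2,
    fun hno => ?_⟩
  · have hsq : (n + 1) * (n + 1) ≤ 4 * (n * n) := by nlinarith
    have hunit : FrontDoor.costUnit n G.numEdges ≤ 2 * (n * (n + G.numEdges)) := by
      have : 0 < n * (n + G.numEdges) := Nat.mul_pos hn (by omega)
      rw [FrontDoor.costUnit]
      omega
    calc (n + 1) * (n + 1) * (187 * FrontDoor.costUnit n G.numEdges)
        ≤ 4 * (n * n) * (187 * (2 * (n * (n + G.numEdges)))) :=
          Nat.mul_le_mul hsq (Nat.mul_le_mul_left _ hunit)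
      _ = 1496 * (n ^ 3 * (n + G.numEdges)) := by ring
  · cases out with
    | none => rfl
    | some Z => exact absurd ⟨Z, h1 Z rfl⟩ hno
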